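/- For a positive integer $r$, an $r$-graph $G$ consists of a finite vertex set $V(G)$ and a set $E(G)$ of $r$-element subsets of $V(G)$ (the edges). For $\vec x=(x_i)_{i\in V(G)}\in\mathbb{R}^{V(G)}$ put $$\lambda(G,\vec x)=\sum_{e\in E(G)}\ \prod_{i\in e}x_i ,$$ and let the Lagrangian of $G$ be $$\lambda(G)=\max\Big\{\lambda(G,\vec x)\;:\; x_i\ge 0 \text{ for all } i\in V(G),\ \sum_{i\in V(G)}x_i=1\Big\}.$$ For distinct $r$-element sets $A,B$ of positive integers, $A$ precedes $B$ in the colex order if $\max(A\triangle B)\in B$. Let $C_{r,m}$ be the $r$-graph whose edges are the first $m$ sets in the colex order of the $r$-element sets of positive integers (and whose vertices are the elements of these sets). **Corollary 1.13.** Let $m$ and $t$ be positive integers with $$\binom{t}{3}-6\;\le\; m\;\le\;\binom{t}{3}-3 .$$ Then the 3-graph $C_{3,m}$ has $m$ edges, and every 3-graph $G$ with $m$ edges satisfies $\lambda(G)\le\lambda(C_{3,m})$. That is, $C_{3,m}$ has the largest Lagrangian among all 3-graphs with $m$ edges, so the Frankl–Füredi conjecture holds for $r=3$ and these values of $m$.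 -/

import Mathlib

/-- A (finite) `r`-graph: a finite vertex set `verts` and a finite set `edges` of `r`-element
subsets of the vertex set. -/
structure RGraph (r : ℕ) (α : Type*) where
  verts : Finset α
  edges : Finset (Finset α)
  subset_verts : ∀ e ∈ edges, e ⊆ verts
  card_eq : ∀ e ∈ edges, e.card = r

namespace RGraph

/-- The Lagrange polynomial `λ(G, x) = ∑_{e ∈ E(G)} ∏_{i ∈ e} x_i`. -/
def lagrangePoly {r : ℕ} {α : Type*} (G : RGraph r α) (x : α → ℝ) : ℝ :=
  ∑ e ∈ G.edges, ∏ i ∈ e, x i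

/-- The legal weightings of `G`: nonnegative weights on the vertices with sum `1`.
Values of `x` outside the vertex set are irrelevant: `G.lagrangePoly x` does not see them. -/
def legalWeightings {r : ℕ} {α : Type*} (G : RGraph r α) : Set (α → ℝ) :=
  {x | (∀ i ∈ G.verts, 0 ≤ x i) ∧ ∑ i ∈ G.verts, x i = 1}

/-- The Lagrangian of `G`: the maximum of `λ(G, x)` over all legal weightings `x`
(see `isGreatest_lagrangian`: the supremum is attained when `G` has a vertex). -/
noncomputable def lagrangian {r : ℕ} {α : Type*} (G : RGraph r α) : ℝ :=
  sSup (G.lagrangePoly '' G.legalWeightings)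

theorem isGreatest_lagrangian {r : ℕ} {α : Type*} (G : RGraph r α) (hG : G.verts.Nonempty) :
    IsGreatest (G.lagrangePoly '' G.legalWeightings) G.lagrangian := by
  classical
  -- extend a weighting of the vertices by zero
  let ext : (G.verts → ℝ) → α → ℝ := fun y i => if h : i ∈ G.verts then y ⟨i, h⟩ else 0
  have hext : Continuous ext := by
    refine continuous_pi fun i => ?_
    by_cases h : i ∈ G.verts
    · simpa [ext, h] using continuous_apply (⟨i, h⟩ : G.verts)
    · simpa [ext, h] using continuous_const
  have hpoly : Continuous G.lagrangePoly := by
    unfold lagrangePoly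
    fun_prop
  have himg : G.lagrangePoly '' G.legalWeightings
      = (G.lagrangePoly ∘ ext) '' stdSimplex ℝ G.verts := by
    ext v
    constructor
    · rintro ⟨x, ⟨hx0, hx1⟩, rfl⟩
      refine ⟨fun i => x i, ⟨fun i => hx0 i i.2, ?_⟩, ?_⟩
      · rw [← hx1]
        exact Finset.sum_coe_sort G.verts x
      · refine Finset.sum_congr rfl fun e he => Finset.prod_congr rfl fun i hi => ?_
        simp [ext, G.subset_verts e he hi]
    · rintro ⟨y, ⟨hy0, hy1⟩, rfl⟩
      refine ⟨ext y, ⟨fun i hi => ?_, ?_⟩, rfl⟩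
      · simpa [ext, hi] using hy0 ⟨i, hi⟩
      · rw [← hy1, ← Finset.sum_coe_sort G.verts]
        exact Finset.sum_congr rfl fun i _ => by simp [ext]
  have hne : (stdSimplex ℝ G.verts).Nonempty := by
    obtain ⟨i, hi⟩ := hG
    exact ⟨_, single_mem_stdSimplex ℝ (⟨i, hi⟩ : G.verts)⟩
  have hc : IsCompact (G.lagrangePoly '' G.legalWeightings) := by
    rw [himg]
    exact (isCompact_stdSimplex ℝ G.verts).image (hpoly.comp hext)
  exact hc.isGreatest_sSup (himg ▸ hne.image _)

end RGraph

/-- The `r`-subsets of the positive integers that strictly precede `A` in the colex order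
(`B < A` iff `B ≠ A` and the largest element of the symmetric difference lies in `A`). -/
def colexBelow (r : ℕ) (A : Finset ℕ+) : Set (Finset ℕ+) :=
  {B | B.card = r ∧ toColex B < toColex A}

/-- The first `m` sets in the colex order of the `r`-subsets of the positive integers:
those with fewer than `m` predecessors. -/
def colexFirst (r m : ℕ) : Set (Finset ℕ+) :=
  {A | A.card = r ∧ (colexBelow r A).encard < m}

theorem colexBelow_encard_lt {r : ℕ} {A B : Finset ℕ+} (hA : A.card = r)
    (hfin : (colexBelow r A).Finite) (h : toColex A < toColex B) :
    (colexBelow r A).encard < (colexBelow r B).encard := by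
  refine hfin.encard_lt_encard ⟨fun C hC => ⟨hC.1, hC.2.trans h⟩, fun hsub => ?_⟩
  exact lt_irrefl _ (hsub (show A ∈ colexBelow r B from ⟨hA, h⟩)).2

theorem colexFirst_injOn (r m : ℕ) :
    Set.InjOn (fun A => (colexBelow r A).encard) (colexFirst r m) := by
  have key : ∀ A ∈ colexFirst r m, (colexBelow r A).Finite := fun A hA =>
    Set.finite_of_encard_le_coe hA.2.le
  intro A hA B hB hAB
  rcases lt_trichotomy (toColex A) (toColex B) with h | h | h
  · exact absurd hAB (colexBelow_encard_lt hA.1 (key A hA) h).ne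
  · exact toColex_inj.1 h
  · exact absurd hAB (colexBelow_encard_lt hB.1 (key B hB) h).ne'

theorem colexFirst_finite (r m : ℕ) : (colexFirst r m).Finite := by
  refine Set.Finite.of_injOn (t := (fun k : ℕ => (k : ℕ∞)) '' Set.Iio m) ?_
    (colexFirst_injOn r m) ((Set.finite_Iio m).image _)
  intro A hA
  obtain ⟨k, hk⟩ := ENat.ne_top_iff_exists.1 (hA.2.trans (ENat.natCast_lt_top m)).ne
  refine ⟨k, ?_, hk⟩
  have h2 := hA.2
  rw [← hk] at h2
  exact_mod_cast h2

/-- `C_{r,m}`: the `r`-graph whose edges are the first `m` sets in the colex order of the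
`r`-subsets of the positive integers, and whose vertices are the elements of these sets. -/
noncomputable def colexGraph (r m : ℕ) : RGraph r ℕ+ where
  verts := (colexFirst_finite r m).toFinset.sup id
  edges := (colexFirst_finite r m).toFinset
  subset_verts := fun _ he => Finset.le_sup (f := id) he
  card_eq := fun _ he => ((colexFirst_finite r m).mem_toFinset.1 he).1

theorem colexBelow_finite (r : ℕ) (A : Finset ℕ+) : (colexBelow r A).Finite := by
  refine ((Finset.Iic (A.sup id)).powerset.finite_toSet).subset fun B hB => ?_
  simp only [Finset.mem_coe, Finset.mem_powerset]
  intro b hb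
  rw [Finset.mem_Iic]
  by_cases hbA : b ∈ A
  · exact Finset.le_sup (f := id) hbA
  · obtain ⟨c, hc, -, hbc⟩ := (Finset.Colex.toColex_le_toColex.1 hB.2.le) hb hbA
    exact hbc.trans (Finset.le_sup (f := id) hc)

/-- For `r ≥ 1` the graph `C_{r,m}` indeed has `m` edges. -/
theorem colexGraph_card_edges {r : ℕ} (hr : 0 < r) (m : ℕ) :
    (colexGraph r m).edges.card = m := by
  suffices h : (colexFirst r m).encard = m by
    have h2 := (colexFirst_finite r m).encard_eq_coe_toFinset_card
    rw [h] at h2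
    exact_mod_cast h2.symm
  have hinf : {A : Finset ℕ+ | A.card = r}.Infinite := by
    intro hfin
    have hcov : (Set.univ : Set ℕ+) ⊆ ⋃ A ∈ {A : Finset ℕ+ | A.card = r}, (A : Set ℕ+) := by
      intro a _
      obtain ⟨s, has, hs⟩ := Infinite.exists_superset_card_eq ({a} : Finset ℕ+) r (by rw [Finset.card_singleton]; exact hr)
      simp only [Set.mem_iUnion]
      exact ⟨s, hs, has (by simp)⟩
    exact Set.infinite_univ ((hfin.biUnion fun A _ => A.finite_toSet).subset hcov)
  induction m with
  | zero => simp [colexFirst]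
  | succ m ih =>
    obtain ⟨A₀, hA₀, hA₀'⟩ := (hinf.sdiff (colexFirst_finite r m)).nonempty
    have hTfin : {B | B.card = r ∧ B ∉ colexFirst r m ∧ toColex B ≤ toColex A₀}.Finite := by
      refine ((colexBelow_finite r A₀).insert A₀).subset fun B hB => ?_
      rcases hB.2.2.eq_or_lt with h | h
      · exact Or.inl (toColex_inj.1 h)
      · exact Or.inr ⟨hB.1, h⟩
    obtain ⟨A, ⟨hA1, hA2, hA3⟩, hmin⟩ :=
      Set.exists_min_image _ (fun B => toColex B) hTfin ⟨A₀, hA₀, hA₀', le_rfl⟩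
    have hbelow : colexBelow r A = colexFirst r m := by
      ext B
      constructor
      · intro hB
        by_contra hBm
        exact (hmin B ⟨hB.1, hBm, hB.2.le.trans hA3⟩).not_gt hB.2
      · intro hB
        refine ⟨hB.1, lt_of_not_ge fun hAB => hA2 ⟨hA1, ?_⟩⟩
        refine lt_of_le_of_lt (Set.encard_le_encard fun C hC => ?_) hB.2
        exact ⟨hC.1, hC.2.trans_le hAB⟩
    have hins : colexFirst r (m + 1) = insert A (colexFirst r m) := by
      ext B
      constructor
      · intro hB
        rcases lt_trichotomy (toColex B) (toColex A) with h | h | h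
        · exact Or.inr (hbelow ▸ ⟨hB.1, h⟩)
        · exact Or.inl (toColex_inj.1 h)
        · exfalso
          have h1 := colexBelow_encard_lt hA1 (colexBelow_finite r A) h
          rw [hbelow, ih] at h1
          have h2 := hB.2
          push_cast at h2
          exact absurd (Order.add_one_le_of_lt h1) h2.not_ge
      · rintro (rfl | hB)
        · refine ⟨hA1, ?_⟩
          rw [hbelow, ih]
          exact_mod_cast Nat.lt_succ_self m
        · exact ⟨hB.1, hB.2.trans (by exact_mod_cast Nat.lt_succ_self m)⟩
    rw [hins, Set.encard_insert_of_notMem hA2, ih]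
    push_cast
    rfl

/-! Vertices are numbered by increasing weight, so 0 and 1 are the lightest. With
$L=\lambda(C_{3,m})$, the claim that at most $m$ triples on $k$ vertices never exceed $L$ is proved
by induction on $k$ (`LagrangianBound`). While $\binom k3\le m$ it is clear, since $C_{3,m}$
contains the complete 3-graph on $k$ vertices.

At a first failing $k$ there is an optimal pair $(H,x)$ whose value cannot be reached with a zero
weight (`IsExtremal`). All weights are then positive, all partial derivatives agree, every two
vertices share an edge (otherwise weight moves between them for free until one vertex disappears),
and $H$ may be taken compressed towards the heavy vertices. In particular every triple through the
heaviest vertex is an edge.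

If $k>t$, then $m\le\binom{k-1}3$ (`IsExtremal.false_of_le_choose`): the weight of 0 is moved to 1,
and the edges through 0, now worthless, are traded for missing triples avoiding 0. The move costs
only $x_0^2$ times the codegree of 0 and 1, and the optimality conditions show that the trade gains
more. For a few small $k$ the bound $m<\binom{k-1}2$ already suffices, as the heaviest vertex alone
has too many edges.

The critical case is $k=t$, with at most six missing triples. Compression makes the missing system
shifted, which leaves a short list (`IsShifted.classification`). The value of the complete 3-graph
depends only on power sums of the weights, so two candidates can be compared through the power sums
of the weights and the polynomials of the missing triples (`IsExtremal.compare`). Every system on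
the list other than a star $\{0,1,2\},\{0,1,3\},\dots$ loses to a competitor with slightly different
weights: usually by `IsExtremal.false_of_swap`, and by explicit reweightings in two symmetric cases.
If a star is missing, then $H$ is $C_{3,m}$ after the relabelling $i\mapsto t-i$, so its value is at
most $L$. -/

open Finset

/-! ### Edge polynomials, weight transfers and power sums -/

section EdgePoly

variable {α : Type*}

/-- The edge polynomial `∑ e ∈ H, ∏ i ∈ e, x i` of a finite set system `H`. -/
def edgePoly (H : Finset (Finset α)) (x : α → ℝ) : ℝ := ∑ e ∈ H, ∏ i ∈ e, x i

theorem edgePoly_mono {H H' : Finset (Finset α)} (h : H ⊆ H') {x : α → ℝ} (hx : ∀ i, 0 ≤ x i) :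
    edgePoly H x ≤ edgePoly H' x :=
  sum_le_sum_of_subset_of_nonneg h fun _ _ _ => prod_nonneg fun i _ => hx i

theorem edgePoly_powersetCard_one (V : Finset α) (x : α → ℝ) :
    edgePoly (powersetCard 1 V) x = ∑ i ∈ V, x i := by
  simp [edgePoly, powersetCard_one]

variable [DecidableEq α]

/-- The partial derivative of `edgePoly H` in the direction of the vertex `w`. -/
def partialPoly (H : Finset (Finset α)) (w : α) (x : α → ℝ) : ℝ :=
  ∑ e ∈ H with w ∈ e, ∏ i ∈ e.erase w, x i

/-- The mixed second partial derivative of `edgePoly H` at the distinct vertices `u`, `v`. -/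
def codegPoly (H : Finset (Finset α)) (u v : α) (x : α → ℝ) : ℝ :=
  ∑ e ∈ H with u ∈ e ∧ v ∈ e, ∏ i ∈ (e.erase u).erase v, x i

/-- Move the weight `s` from `v` to `u`. -/
def shiftWeight (x : α → ℝ) (u v : α) (s : ℝ) : α → ℝ :=
  fun i => if i = u then x i + s else if i = v then x i - s else x i

theorem shiftWeight_left (x : α → ℝ) (u v : α) (s : ℝ) : shiftWeight x u v s u = x u + s := by
  simp [shiftWeight]

theorem shiftWeight_right (x : α → ℝ) {u v : α} (h : u ≠ v) (s : ℝ) :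
    shiftWeight x u v s v = x v - s := by
  simp [shiftWeight, h.symm]

theorem shiftWeight_of_ne (x : α → ℝ) {u v i : α} (hu : i ≠ u) (hv : i ≠ v) (s : ℝ) :
    shiftWeight x u v s i = x i := by
  simp [shiftWeight, hu, hv]

theorem prod_shiftWeight_of_notMem (x : α → ℝ) {u v : α} (s : ℝ) {e : Finset α}
    (hu : u ∉ e) (hv : v ∉ e) : ∏ i ∈ e, shiftWeight x u v s i = ∏ i ∈ e, x i :=
  prod_congr rfl fun _ hi => shiftWeight_of_ne x (ne_of_mem_of_not_mem hi hu)
    (ne_of_mem_of_not_mem hi hv) s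

theorem prod_shiftWeight (x : α → ℝ) {u v : α} (h : u ≠ v) (s : ℝ) (e : Finset α) :
    ∏ i ∈ e, shiftWeight x u v s i = ∏ i ∈ e, x i
      + s * ((if u ∈ e then ∏ i ∈ e.erase u, x i else 0)
        - (if v ∈ e then ∏ i ∈ e.erase v, x i else 0))
      - s ^ 2 * (if u ∈ e ∧ v ∈ e then ∏ i ∈ (e.erase u).erase v, x i else 0) := by
  by_cases hu : u ∈ e <;> by_cases hv : v ∈ e
  · have hv' : v ∈ e.erase u := mem_erase.2 ⟨h.symm, hv⟩
    have hu' : u ∈ e.erase v := mem_erase.2 ⟨h, hu⟩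
    simp only [hu, hv, and_self, if_true]
    rw [← mul_prod_erase e _ hu, ← mul_prod_erase _ _ hv', ← mul_prod_erase e x hu,
      ← mul_prod_erase _ x hv', ← mul_prod_erase _ x hu', erase_right_comm (a := v),
      prod_shiftWeight_of_notMem x s (by simp) (by simp), shiftWeight_left,
      shiftWeight_right x h]
    ring
  · simp only [hu, hv, and_false, if_true, if_false]
    rw [← mul_prod_erase e _ hu, ← mul_prod_erase e x hu,
      prod_shiftWeight_of_notMem x s (by simp) (by simp [hv]), shiftWeight_left]
    ring
  · simp only [hu, hv, false_and, if_true, if_false]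
    rw [← mul_prod_erase e _ hv, ← mul_prod_erase e x hv,
      prod_shiftWeight_of_notMem x s (by simp [hu]) (by simp), shiftWeight_right x h]
    ring
  · simp [hu, hv, prod_shiftWeight_of_notMem x s hu hv]

/-- The edge polynomial is multilinear, so along a transfer between two vertices its Taylor
expansion stops at order two and is exact. Nonnegativity of the codegree makes it concave there when
the weights are nonnegative. -/
theorem edgePoly_shiftWeight (H : Finset (Finset α)) (x : α → ℝ) {u v : α} (h : u ≠ v) (s : ℝ) :
    edgePoly H (shiftWeight x u v s) = edgePoly H x
      + s * (partialPoly H u x - partialPoly H v x) - s ^ 2 * codegPoly H u v x := by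
  simp only [edgePoly, partialPoly, codegPoly, sum_filter]
  rw [← sum_sub_distrib, mul_sum, mul_sum, ← sum_add_distrib, ← sum_sub_distrib]
  exact sum_congr rfl fun e _ => prod_shiftWeight x h s e

theorem sum_shiftWeight {V : Finset α} (x : α → ℝ) {u v : α} (h : u ≠ v) (hu : u ∈ V)
    (hv : v ∈ V) (s : ℝ) : ∑ i ∈ V, shiftWeight x u v s i = ∑ i ∈ V, x i := by
  have key : ∀ i, shiftWeight x u v s i = x i + ((if i = u then s else 0)
      - (if i = v then s else 0)) := by
    intro i
    by_cases h1 : i = u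
    · have : i ≠ v := h1 ▸ h
      simp [shiftWeight, h1, h]
    · by_cases h2 : i = v <;> simp [shiftWeight, h1, h2, h.symm, sub_eq_add_neg]
  simp [key, sum_add_distrib, hu, hv]

theorem edgePoly_sdiff_add {H K : Finset (Finset α)} (h : H ⊆ K) (x : α → ℝ) :
    edgePoly (K \ H) x + edgePoly H x = edgePoly K x := sum_sdiff h

theorem edgePoly_union {H K : Finset (Finset α)} (h : Disjoint H K) (x : α → ℝ) :
    edgePoly (H ∪ K) x = edgePoly H x + edgePoly K x := sum_union h

theorem edgePoly_insert {H : Finset (Finset α)} {e : Finset α} (h : e ∉ H) (x : α → ℝ) :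
    edgePoly (insert e H) x = ∏ i ∈ e, x i + edgePoly H x := sum_insert h

theorem partialPoly_sdiff_add {H K : Finset (Finset α)} (h : H ⊆ K) (w : α) (x : α → ℝ) :
    partialPoly (K \ H) w x + partialPoly H w x = partialPoly K w x := by
  simp only [partialPoly, sum_filter]
  exact sum_sdiff h

theorem partialPoly_insert {H : Finset (Finset α)} {e : Finset α} (h : e ∉ H) (w : α)
    (x : α → ℝ) : partialPoly (insert e H) w x
      = (if w ∈ e then ∏ i ∈ e.erase w, x i else 0) + partialPoly H w x := by
  simp only [partialPoly, sum_filter]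
  exact sum_insert h

/-- Euler's identity for homogeneous polynomials. -/
theorem sum_mul_partialPoly {r : ℕ} {V : Finset α} {H : Finset (Finset α)}
    (hH : H ⊆ powersetCard r V) (x : α → ℝ) :
    ∑ w ∈ V, x w * partialPoly H w x = r * edgePoly H x := by
  simp only [partialPoly, edgePoly, sum_filter, mul_sum]
  rw [sum_comm]
  refine sum_congr rfl fun e he => ?_
  obtain ⟨heV, hr⟩ := mem_powersetCard.1 (hH he)
  have : ∀ w ∈ V, (x w * if w ∈ e then ∏ i ∈ e.erase w, x i else 0)
      = if w ∈ e then ∏ i ∈ e, x i else 0 := by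
    intro w _
    split_ifs with hw
    · exact mul_prod_erase e x hw
    · simp
  rw [sum_congr rfl this, ← sum_filter, filter_mem_eq_inter, inter_eq_right.2 heV, sum_const, hr,
    nsmul_eq_mul]

theorem edgePoly_powersetCard_insert {V : Finset α} {a : α} (ha : a ∉ V) (n : ℕ) (x : α → ℝ) :
    edgePoly (powersetCard (n + 1) (insert a V)) x
      = edgePoly (powersetCard (n + 1) V) x + x a * edgePoly (powersetCard n V) x := by
  have hn : ∀ e ∈ powersetCard n V, a ∉ e := fun e he h => ha ((mem_powersetCard.1 he).1 h)
  rw [powersetCard_succ_insert ha, edgePoly_union]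
  · congr 1
    simp only [edgePoly]
    rw [sum_image, mul_sum]
    · exact sum_congr rfl fun e he => prod_insert (hn e he)
    · intro e he f hf hef
      rw [← erase_insert (hn e he), ← erase_insert (hn f hf), hef]
  · rw [disjoint_left]
    intro e he he'
    obtain ⟨f, _, rfl⟩ := mem_image.1 he'
    exact ha ((mem_powersetCard.1 he).1 (mem_insert_self a f))

theorem two_mul_edgePoly_powersetCard_two (V : Finset α) (x : α → ℝ) :
    2 * edgePoly (powersetCard 2 V) x = (∑ i ∈ V, x i) ^ 2 - ∑ i ∈ V, x i ^ 2 := by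
  induction V using Finset.induction_on with
  | empty => rw [edgePoly, powersetCard_eq_empty.2 (by simp)]; simp
  | insert a V ha ih =>
    rw [edgePoly_powersetCard_insert ha 1, edgePoly_powersetCard_one, sum_insert ha, sum_insert ha]
    linear_combination ih

/-- Newton's identity for the third elementary symmetric polynomial. Through it a dense 3-graph is
studied by its few missing triples: the complete part only sees power sums of the weights. -/
theorem six_mul_edgePoly_powersetCard_three (V : Finset α) (x : α → ℝ) :
    6 * edgePoly (powersetCard 3 V) x = (∑ i ∈ V, x i) ^ 3
      - 3 * (∑ i ∈ V, x i) * ∑ i ∈ V, x i ^ 2 + 2 * ∑ i ∈ V, x i ^ 3 := by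
  induction V using Finset.induction_on with
  | empty => rw [edgePoly, powersetCard_eq_empty.2 (by simp)]; simp
  | insert a V ha ih =>
    rw [edgePoly_powersetCard_insert ha 2, sum_insert ha, sum_insert ha, sum_insert ha]
    linear_combination ih + 3 * x a * two_mul_edgePoly_powersetCard_two V x

theorem partialPoly_powersetCard {V : Finset α} {w : α} (hw : w ∈ V) (n : ℕ) (x : α → ℝ) :
    partialPoly (powersetCard (n + 1) V) w x = edgePoly (powersetCard n (V.erase w)) x := by
  refine sum_nbij' (fun e => e.erase w) (fun e => insert w e) ?_ ?_ ?_ ?_ ?_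
  · intro e he
    obtain ⟨he, hwe⟩ := mem_filter.1 he
    obtain ⟨heV, hc⟩ := mem_powersetCard.1 he
    exact mem_powersetCard.2 ⟨erase_subset_erase w heV, by rw [card_erase_of_mem hwe, hc]; rfl⟩
  · intro e he
    obtain ⟨heV, hc⟩ := mem_powersetCard.1 he
    have hwe : w ∉ e := fun h => by simpa using heV h
    refine mem_filter.2 ⟨mem_powersetCard.2 ⟨?_, by rw [card_insert_of_notMem hwe, hc]⟩,
      mem_insert_self w e⟩
    exact insert_subset hw (heV.trans (erase_subset w V))
  · intro e he
    exact insert_erase (mem_filter.1 he).2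
  · intro e he
    have hwe : w ∉ e := fun h => by simpa using (mem_powersetCard.1 he).1 h
    exact erase_insert hwe
  · intro e _
    rfl

theorem two_mul_partialPoly_powersetCard_three {V : Finset α} {w : α} (hw : w ∈ V) {x : α → ℝ}
    (hx : ∑ i ∈ V, x i = 1) :
    2 * partialPoly (powersetCard 3 V) w x
      = 1 - 2 * x w + 2 * x w ^ 2 - ∑ i ∈ V, x i ^ 2 := by
  rw [partialPoly_powersetCard hw, two_mul_edgePoly_powersetCard_two]
  have h1 := add_sum_erase V x hw
  have h2 := add_sum_erase V (fun i => x i ^ 2) hw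
  rw [hx] at h1
  rw [← h2, show ∑ i ∈ V.erase w, x i = 1 - x w by linarith]
  ring

end EdgePoly

/-! ### Relabelling the vertices by weight -/

section Transport

variable {α : Type*} [DecidableEq α]

/-- Relabel the vertices of a weighted `3`-graph by `0, …, k - 1` in the order of their weights. -/
theorem exists_sorted_relabelling {V : Finset α} {k : ℕ} (hk : V.card = k)
    {H : Finset (Finset α)} (h3 : ∀ e ∈ H, e.card = 3) {x : α → ℝ} (hx : ∀ i ∈ V, 0 ≤ x i)
    (hH : ∀ e ∈ H, ¬ e ⊆ V → ∏ i ∈ e, x i = 0) :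
    ∃ H' ⊆ powersetCard 3 (range k), H'.card ≤ H.card ∧ ∃ y : ℕ → ℝ, (∀ i, 0 ≤ y i) ∧
      ∑ i ∈ range k, y i = ∑ i ∈ V, x i ∧ (∀ i j, i ≤ j → j < k → y i ≤ y j) ∧
      edgePoly H' y = edgePoly H x := by
  classical
  let f : V ≃ Fin k := V.equivFinOfCardEq hk
  let σ := Tuple.sort (fun i : Fin k => x (f.symm i))
  let g : V ≃ Fin k := f.trans σ.symm
  have hgmono : Monotone fun i : Fin k => x (g.symm i) :=
    Tuple.monotone_sort (fun i : Fin k => x (f.symm i))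
  let y : ℕ → ℝ := fun i => if h : i < k then x (g.symm ⟨i, h⟩) else 0
  let φ : α → ℕ := fun a => if h : a ∈ V then (g ⟨a, h⟩ : ℕ) else 0
  have hφ : ∀ a (h : a ∈ V), φ a = (g ⟨a, h⟩ : ℕ) := fun a h => dif_pos h
  have hφlt : ∀ a ∈ V, φ a < k := fun a h => by rw [hφ a h]; exact (g ⟨a, h⟩).2
  have hyφ : ∀ a ∈ V, y (φ a) = x a := by
    intro a h
    simp only [y, hφlt a h, dif_pos]
    congr
    simp [hφ a h]
  have hinj : Set.InjOn φ V := by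
    intro a ha b hb hab
    rw [hφ a ha, hφ b hb] at hab
    simpa using g.injective (Fin.ext hab)
  have himg : V.image φ = range k := by
    refine eq_of_subset_of_card_le (fun i hi => ?_) ?_
    · obtain ⟨a, ha, rfl⟩ := mem_image.1 hi
      exact mem_range.2 (hφlt a ha)
    · rw [card_image_of_injOn hinj, hk, card_range]
  -- Edges leaving `V` are discarded: their monomials vanish by `hH`, and `φ` is injective only on
  -- `V`.
  have hinj2 : Set.InjOn (fun e : Finset α => e.image φ) (H.filter (· ⊆ V)) := by
    intro e he e' he' hee
    have h1 := (mem_filter.1 he).2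
    have h2 := (mem_filter.1 he').2
    have hee : e.image φ = e'.image φ := hee
    ext a
    constructor
    · intro ha
      obtain ⟨b, hb, hab⟩ := mem_image.1 (hee ▸ mem_image_of_mem φ ha)
      rwa [← hinj (h2 hb) (h1 ha) hab]
    · intro ha
      obtain ⟨b, hb, hab⟩ := mem_image.1 (hee ▸ mem_image_of_mem φ ha)
      rwa [← hinj (h1 hb) (h2 ha) hab]
  refine ⟨(H.filter (· ⊆ V)).image (fun e => e.image φ), ?_,
    card_image_le.trans (card_filter_le _ _), y, ?_, ?_, ?_, ?_⟩
  · intro e' he'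
    obtain ⟨e, he, rfl⟩ := mem_image.1 he'
    obtain ⟨heH, heV⟩ := mem_filter.1 he
    refine mem_powersetCard.2 ⟨himg ▸ image_subset_image heV, ?_⟩
    rw [card_image_of_injOn (hinj.mono heV), h3 e heH]
  · intro i
    by_cases h : i < k
    · simp only [y, h, dif_pos]
      exact hx _ (g.symm ⟨i, h⟩).2
    · simp [y, h]
  · rw [← himg, sum_image hinj]
    exact sum_congr rfl hyφ
  · intro i j hij hj
    simp only [y, hj, hij.trans_lt hj, dif_pos]
    exact hgmono (show (⟨i, hij.trans_lt hj⟩ : Fin k) ≤ ⟨j, hj⟩ from hij)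
  · rw [edgePoly, sum_image hinj2, edgePoly, sum_filter]
    refine sum_congr rfl fun e he => ?_
    split_ifs with heV
    · rw [prod_image (hinj.mono heV)]
      exact prod_congr rfl fun a ha => hyφ a (heV ha)
    · exact (hH e he heV).symm

end Transport

/-! ### Extremal counterexamples: existence -/

/-- `L` bounds the Lagrangians of all `3`-graphs with at most `m` edges on `k` vertices. -/
def LagrangianBound (m k : ℕ) (L : ℝ) : Prop :=
  ∀ H ⊆ powersetCard 3 (range k), H.card ≤ m → ∀ x : ℕ → ℝ, (∀ i, 0 ≤ x i) →
    ∑ i ∈ range k, x i = 1 → edgePoly H x ≤ L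

/-- A weighted `3`-graph on `0, …, k - 1` with at most `m` edges and the largest possible value
of the edge polynomial, normalised so that the weights increase and the edges are compressed
towards the heavy vertices, in a situation where fewer than `k` vertices only yield values up to
`L`. -/
structure IsExtremal (m k : ℕ) (L : ℝ) (H : Finset (Finset ℕ)) (x : ℕ → ℝ) : Prop where
  subset : H ⊆ powersetCard 3 (range k)
  card_le : H.card ≤ m
  nonneg : ∀ i, 0 ≤ x i
  sum_eq : ∑ i ∈ range k, x i = 1
  mono : ∀ i j, i ≤ j → j < k → x i ≤ x j
  lt : L < edgePoly H x
  max : ∀ H' ⊆ powersetCard 3 (range k), H'.card ≤ m → ∀ y : ℕ → ℝ, (∀ i, 0 ≤ y i) →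
    ∑ i ∈ range k, y i = 1 → edgePoly H' y ≤ edgePoly H x
  vanish : ∀ H' ⊆ powersetCard 3 (range k), H'.card ≤ m → ∀ y : ℕ → ℝ, (∀ i, 0 ≤ y i) →
    ∑ i ∈ range k, y i = 1 → ∀ v < k, y v = 0 → edgePoly H' y ≤ L
  up : ∀ e ∈ H, ∀ j ∈ e, ∀ i < k, i ∉ e → j < i → insert i (e.erase j) ∈ H

theorem LagrangianBound.of_vanish {m k : ℕ} {L : ℝ} (h : LagrangianBound m k L)
    {H : Finset (Finset ℕ)} (hH : H ⊆ powersetCard 3 (range (k + 1))) (hm : H.card ≤ m)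
    {x : ℕ → ℝ} (hx : ∀ i, 0 ≤ x i) (hs : ∑ i ∈ range (k + 1), x i = 1) {v : ℕ} (hv : v < k + 1)
    (hxv : x v = 0) : edgePoly H x ≤ L := by
  have hv' : v ∈ range (k + 1) := mem_range.2 hv
  obtain ⟨H', hH', hc, y, hy, hys, -, hp⟩ := exists_sorted_relabelling
    (V := (range (k + 1)).erase v) (k := k) (by rw [card_erase_of_mem hv', card_range]; rfl)
    (fun e he => (mem_powersetCard.1 (hH he)).2) (fun i _ => hx i) (by
      intro e he hne
      have : v ∈ e := by
        by_contra hve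
        exact hne fun i hi => mem_erase.2
          ⟨ne_of_mem_of_not_mem hi hve, (mem_powersetCard.1 (hH he)).1 hi⟩
      exact prod_eq_zero this hxv)
  rw [← hp]
  refine h H' hH' (hc.trans hm) y hy ?_
  rw [hys, ← hs, ← add_sum_erase _ _ hv', hxv, zero_add]

theorem edgePoly_congr {k : ℕ} {H : Finset (Finset ℕ)} (hH : H ⊆ powersetCard 3 (range k))
    {x y : ℕ → ℝ} (h : ∀ i < k, x i = y i) : edgePoly H x = edgePoly H y :=
  sum_congr rfl fun _ he => prod_congr rfl fun i hi =>
    h i (mem_range.1 ((mem_powersetCard.1 (hH he)).1 hi))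

/-- Weights live on all of `ℕ`. Pinning the irrelevant coordinates to zero gives a closed part of a
product of intervals, compact by Tychonoff's theorem. -/
theorem isCompact_weightings (k : ℕ) :
    IsCompact {x : ℕ → ℝ | (∀ i, 0 ≤ x i) ∧ (∀ i, k ≤ i → x i = 0) ∧ ∑ i ∈ range k, x i = 1} := by
  have h1 : IsCompact (Set.univ.pi fun i : ℕ => Set.Icc (0 : ℝ) (if i < k then 1 else 0)) :=
    isCompact_univ_pi fun i => isCompact_Icc
  have h2 : IsClosed {x : ℕ → ℝ | ∑ i ∈ range k, x i = 1} :=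
    isClosed_eq (by fun_prop) continuous_const
  convert h1.inter_right h2 using 1
  ext x
  simp only [Set.mem_ofPred_eq, Set.mem_inter_iff, Set.mem_pi, Set.mem_univ, true_imp_iff,
    Set.mem_Icc]
  constructor
  · rintro ⟨h0, hz, hs⟩
    refine ⟨fun i => ⟨h0 i, ?_⟩, hs⟩
    split_ifs with h
    · exact hs ▸ single_le_sum (fun j _ => h0 j) (mem_range.2 h)
    · exact (hz i (not_lt.1 h)).le
  · rintro ⟨h, hs⟩
    refine ⟨fun i => (h i).1, fun i hi => le_antisymm ?_ (h i).1, hs⟩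
    simpa [not_lt.2 hi] using (h i).2

theorem exists_max_edgePoly (m k : ℕ) (hk : 0 < k) :
    ∃ H ⊆ powersetCard 3 (range k), H.card ≤ m ∧ ∃ x : ℕ → ℝ, (∀ i, 0 ≤ x i) ∧
      ∑ i ∈ range k, x i = 1 ∧
      ∀ H' ⊆ powersetCard 3 (range k), H'.card ≤ m → ∀ y : ℕ → ℝ, (∀ i, 0 ≤ y i) →
        ∑ i ∈ range k, y i = 1 → edgePoly H' y ≤ edgePoly H x := by
  set K := {x : ℕ → ℝ | (∀ i, 0 ≤ x i) ∧ (∀ i, k ≤ i → x i = 0) ∧ ∑ i ∈ range k, x i = 1}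
  have hK : IsCompact K := isCompact_weightings k
  have hne : K.Nonempty := by
    refine ⟨fun i => if i = 0 then 1 else 0, fun i => ?_, fun i hi => ?_, ?_⟩
    · dsimp only
      split_ifs <;> norm_num
    · exact if_neg (by omega)
    · simp [hk]
  have hcont : ∀ H : Finset (Finset ℕ), Continuous fun x : ℕ → ℝ => edgePoly H x := by
    intro H
    unfold edgePoly
    fun_prop
  have hmax : ∀ H : Finset (Finset ℕ), ∃ x ∈ K, ∀ y ∈ K, edgePoly H y ≤ edgePoly H x := fun H =>
    hK.exists_isMaxOn hne (hcont H).continuousOn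
  choose X hXK hX using hmax
  obtain ⟨H, hH, hHmax⟩ := exists_max_image
    ((powersetCard 3 (range k)).powerset.filter fun H => H.card ≤ m) (fun H => edgePoly H (X H))
    ⟨∅, by simp⟩
  simp only [mem_filter, mem_powerset] at hH hHmax
  refine ⟨H, hH.1, hH.2, X H, (hXK H).1, (hXK H).2.2, fun H' hH' hc y hy hs => ?_⟩
  refine le_trans ?_ (hHmax H' ⟨hH', hc⟩)
  rw [edgePoly_congr hH' (y := fun i => if i < k then y i else 0) fun i hi => by simp [hi]]
  refine hX H' _ ⟨fun i => ?_, fun i hi => by simp [not_lt.2 hi], ?_⟩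
  · dsimp only
    split_ifs
    · exact hy i
    · exact le_rfl
  · rw [← hs]
    exact sum_congr rfl fun i hi => by simp [mem_range.1 hi]

theorem exists_isExtremal {m k : ℕ} {L : ℝ} (h : LagrangianBound m k L)
    (h' : ¬ LagrangianBound m (k + 1) L) :
    ∃ H x, IsExtremal m (k + 1) L H x := by
  obtain ⟨H₀, hH₀, hc₀, x₀, hx₀, hs₀, hmax₀⟩ := exists_max_edgePoly m (k + 1) k.succ_pos
  obtain ⟨H₁, hH₁, hc₁, x, hx, hs, hmono, hval⟩ := exists_sorted_relabelling
    (V := range (k + 1)) (card_range _) (fun e he => (mem_powersetCard.1 (hH₀ he)).2)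
    (fun i _ => hx₀ i) (fun e he hne => absurd (mem_powersetCard.1 (hH₀ he)).1 hne)
  rw [hs₀] at hs
  rw [← hval] at hmax₀
  have hlt : L < edgePoly H₁ x := by
    by_contra hle
    exact h' fun H hH hm y hy hys => (hmax₀ H hH hm y hy hys).trans (not_lt.1 hle)
  -- Among the graphs with the optimal value at `x`, one with the largest sum of labels is taken. As
  -- weights increase with labels, a failing compression would keep the value optimal and increase
  -- this sum.
  obtain ⟨H, hH, hHmax⟩ := exists_max_image
    ((powersetCard 3 (range (k + 1))).powerset.filter fun H => H.card ≤ m ∧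
      edgePoly H x = edgePoly H₁ x) (fun H => ∑ e ∈ H, ∑ i ∈ e, i)
    ⟨H₁, by simp [hH₁, hc₁.trans hc₀]⟩
  simp only [mem_filter, mem_powerset] at hH hHmax
  obtain ⟨hHsub, hHc, hHv⟩ := hH
  rw [← hHv] at hmax₀ hlt hHmax
  refine ⟨H, x, hHsub, hHc, hx, hs, hmono, hlt, hmax₀,
    fun H' hH' hc y hy hys v hv hyv => h.of_vanish hH' hc hy hys hv hyv, ?_⟩
  intro e he j hj i hi hie hji
  by_contra hn
  obtain ⟨heV, he3⟩ := mem_powersetCard.1 (hHsub he)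
  have hie' : i ∉ e.erase j := fun h => hie (mem_of_mem_erase h)
  have hn' : insert i (e.erase j) ∉ H.erase e := fun h => hn (mem_of_mem_erase h)
  have hsub' : insert (insert i (e.erase j)) (H.erase e) ⊆ powersetCard 3 (range (k + 1)) := by
    refine insert_subset (mem_powersetCard.2 ⟨insert_subset (mem_range.2 hi)
      ((erase_subset _ _).trans heV), ?_⟩) ((erase_subset _ _).trans hHsub)
    rw [card_insert_of_notMem hie', card_erase_of_mem hj, he3]
  have hcard' : (insert (insert i (e.erase j)) (H.erase e)).card ≤ m := by
    rw [card_insert_of_notMem hn', card_erase_of_mem he]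
    have := card_pos.2 ⟨e, he⟩
    omega
  have hge : edgePoly H x ≤ edgePoly (insert (insert i (e.erase j)) (H.erase e)) x := by
    rw [edgePoly_insert hn', prod_insert hie', edgePoly, ← add_sum_erase H _ he,
      ← mul_prod_erase e x hj]
    exact add_le_add_left (mul_le_mul_of_nonneg_right (hmono j i hji.le hi)
      (prod_nonneg fun i _ => hx i)) _
  have := hHmax _ ⟨hsub', hcard', le_antisymm (hmax₀ _ hsub' hcard' x hx hs) hge⟩
  rw [sum_insert hn', sum_insert hie', ← add_sum_erase H _ he, ← add_sum_erase e _ hj] at this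
  omega

/-! ### Optimality conditions and covered pairs -/

namespace IsExtremal

variable {m k : ℕ} {L : ℝ} {H : Finset (Finset ℕ)} {x : ℕ → ℝ}

theorem pos (h : IsExtremal m k L H x) {i : ℕ} (hi : i < k) : 0 < x i :=
  (h.nonneg i).lt_of_ne fun h0 =>
    (h.vanish H h.subset h.card_le x h.nonneg h.sum_eq i hi h0.symm).not_gt h.lt

theorem prod_pos (h : IsExtremal m k L H x) {e : Finset ℕ} (he : e ⊆ range k) :
    0 < ∏ i ∈ e, x i := Finset.prod_pos fun _ hi => h.pos (mem_range.1 (he hi))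

theorem card_eq (h : IsExtremal m k L H x) (hm : m ≤ k.choose 3) : H.card = m := by
  refine le_antisymm h.card_le (not_lt.1 fun hlt => ?_)
  have hne : H ≠ powersetCard 3 (range k) := by
    intro heq
    rw [heq, card_powersetCard, card_range] at hlt
    omega
  obtain ⟨e, he, heH⟩ := exists_of_ssubset (h.subset.ssubset_of_ne hne)
  have := h.max (insert e H) (insert_subset he h.subset)
    (by rw [card_insert_of_notMem heH]; omega) x h.nonneg h.sum_eq
  rw [edgePoly_insert heH] at this
  linarith [h.prod_pos (mem_powersetCard.1 he).1]

theorem shiftWeight_nonneg (h : IsExtremal m k L H x) {u v : ℕ} (huv : u ≠ v) {s : ℝ}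
    (hs : 0 ≤ s) (hsv : s ≤ x v) (i : ℕ) : 0 ≤ shiftWeight x u v s i := by
  have := h.nonneg i
  unfold shiftWeight
  split_ifs with h1 h2
  · linarith
  · subst h2; linarith
  · exact this

theorem sum_shiftWeight_eq (h : IsExtremal m k L H x) {u v : ℕ} (hu : u < k) (hv : v < k)
    (huv : u ≠ v) (s : ℝ) : ∑ i ∈ range k, shiftWeight x u v s i = 1 := by
  rw [sum_shiftWeight x huv (mem_range.2 hu) (mem_range.2 hv), h.sum_eq]

/-- All weights are positive, so a little weight can be moved from `v` to `u`; a larger derivative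
at `u` would increase the value. By symmetry all partial derivatives agree. -/
theorem partialPoly_le (h : IsExtremal m k L H x) {u v : ℕ} (hu : u < k) (hv : v < k) :
    partialPoly H u x ≤ partialPoly H v x := by
  rcases eq_or_ne u v with rfl | huv
  · exact le_rfl
  by_contra! hlt
  set D := partialPoly H u x - partialPoly H v x with hD
  have hD0 : 0 < D := sub_pos.2 hlt
  set C := codegPoly H u v x with hC
  have hC0 : 0 ≤ C := sum_nonneg fun _ _ => prod_nonneg fun i _ => h.nonneg i
  have key : ∀ s, 0 ≤ s → s ≤ x v → s * D - s ^ 2 * C ≤ 0 := by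
    intro s hs hsv
    have := h.max H h.subset h.card_le _ (h.shiftWeight_nonneg huv hs hsv)
      (h.sum_shiftWeight_eq hu hv huv s)
    rw [edgePoly_shiftWeight H x huv] at this
    linarith
  -- The second entry keeps the quadratic loss $s^2C$ below half of the linear gain $sD$; the extra
  -- 1 covers $C=0$.
  have hs : 0 < min (x v) (D / (2 * (C + 1))) := lt_min (h.pos hv) (by positivity)
  have h1 := key _ hs.le (min_le_left _ _)
  have h2 : min (x v) (D / (2 * (C + 1))) * (2 * (C + 1)) ≤ D :=
    (le_div_iff₀ (by positivity)).1 (min_le_right _ _)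
  set s := min (x v) (D / (2 * (C + 1)))
  nlinarith [mul_pos hs hD0]

theorem partialPoly_eq (h : IsExtremal m k L H x) {u v : ℕ} (hu : u < k) (hv : v < k) :
    partialPoly H u x = partialPoly H v x :=
  le_antisymm (h.partialPoly_le hu hv) (h.partialPoly_le hv hu)

theorem edgePoly_shiftWeight_eq (h : IsExtremal m k L H x) {u v : ℕ} (hu : u < k) (hv : v < k)
    (huv : u ≠ v) (s : ℝ) :
    edgePoly H (shiftWeight x u v s) = edgePoly H x - s ^ 2 * codegPoly H u v x := by
  rw [edgePoly_shiftWeight H x huv, h.partialPoly_eq hu hv]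
  ring

/-- Without a common edge the codegree is zero, so moving all the weight of `v` to `u` costs
nothing. This reaches the same value with a zero weight, against `vanish`. -/
theorem exists_edge (h : IsExtremal m k L H x) {u v : ℕ} (hu : u < k) (hv : v < k)
    (huv : u ≠ v) : ∃ e ∈ H, u ∈ e ∧ v ∈ e := by
  by_contra! hn
  have hC : codegPoly H u v x = 0 := by
    rw [codegPoly, filter_eq_empty_iff.2 (fun {e} he huve => hn e he huve.1 huve.2), sum_empty]
  have h1 := h.edgePoly_shiftWeight_eq hu hv huv (x v)
  rw [hC, mul_zero, sub_zero] at h1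
  have h2 := h.vanish H h.subset h.card_le _ (h.shiftWeight_nonneg huv (h.nonneg v) le_rfl)
    (h.sum_shiftWeight_eq hu hv huv _) v hv (by rw [shiftWeight_right x huv, sub_self])
  linarith [h.lt]

theorem partialPoly_eq_three_mul (h : IsExtremal m k L H x) {u : ℕ} (hu : u < k) :
    partialPoly H u x = 3 * edgePoly H x := by
  have h1 := sum_mul_partialPoly h.subset x
  rw [sum_congr rfl fun w hw => by rw [h.partialPoly_eq (mem_range.1 hw) hu], ← sum_mul,
    h.sum_eq, one_mul] at h1
  exact_mod_cast h1

end IsExtremal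

/-! ### Averaging, compression and the heaviest vertex -/

theorem card_filter_mem_powersetCard {α : Type*} [DecidableEq α] {V : Finset α} {w : α}
    (hw : w ∈ V) (n : ℕ) :
    ((powersetCard (n + 1) V).filter (w ∈ ·)).card = (V.card - 1).choose n := by
  have h := partialPoly_powersetCard hw n (fun _ => (1 : ℝ))
  simp only [partialPoly, edgePoly, prod_const_one, sum_const, nsmul_eq_mul, mul_one,
    card_powersetCard, card_erase_of_mem hw] at h
  exact_mod_cast h

/-- Discarding a lightest element never lowers the average; this is repeated until `d` elements
remain. -/
theorem exists_subset_card_mul_sum_le {ι : Type*} [DecidableEq ι] (w : ι → ℝ) (d : ℕ)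
    (s : Finset ι) (hd : d ≤ s.card) :
    ∃ t ⊆ s, t.card = d ∧ d * ∑ i ∈ s, w i ≤ s.card * ∑ i ∈ t, w i := by
  induction s using Finset.strongInduction with
  | H s ih =>
    rcases hd.eq_or_lt with h | h
    · exact ⟨s, subset_rfl, h.symm, by rw [h]⟩
    obtain ⟨a, ha, hmin⟩ := exists_min_image s w (card_pos.1 (by omega))
    obtain ⟨t, ht, htd, hle⟩ := ih (s.erase a) (erase_ssubset ha)
      (by rw [card_erase_of_mem ha]; omega)
    refine ⟨t, ht.trans (erase_subset a s), htd, ?_⟩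
    rcases Nat.eq_zero_or_pos d with rfl | hd0
    · rw [card_eq_zero.1 htd]
      simp
    have hsum := add_sum_erase s w ha
    have hn : ((s.erase a).card : ℝ) = s.card - 1 := by
      rw [card_erase_of_mem ha, Nat.cast_sub (by omega)]
      simp
    have h1 : (s.card : ℝ) * w a ≤ ∑ i ∈ s, w i := by
      have := card_nsmul_le_sum s w (w a) hmin
      rwa [nsmul_eq_mul] at this
    have h2 : (2 : ℝ) ≤ s.card := by exact_mod_cast (by omega : 2 ≤ s.card)
    have h3 : (0 : ℝ) < d := by exact_mod_cast hd0
    rw [hn] at hle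
    refine le_of_mul_le_mul_left ?_ (by linarith : (0 : ℝ) < s.card - 1)
    have h4 := mul_le_mul_of_nonneg_left h1 h3.le
    have h5 : (s.card : ℝ) * (d * ∑ i ∈ s.erase a, w i)
        ≤ s.card * ((s.card - 1) * ∑ i ∈ t, w i) := mul_le_mul_of_nonneg_left hle (by linarith)
    rw [← hsum] at h4 ⊢
    nlinarith

namespace IsExtremal

variable {m k : ℕ} {L : ℝ} {H : Finset (Finset ℕ)} {x : ℕ → ℝ}

/-- An edge through the two lightest vertices forces all edges through its third vertex. -/
theorem mem_of_zero_one_mem (h : IsExtremal m k L H x) {i : ℕ} (hi : 2 ≤ i)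
    (hH : {0, 1, i} ∈ H) {e : Finset ℕ} (he : e ∈ powersetCard 3 (range k)) (hie : i ∈ e) :
    e ∈ H := by
  obtain ⟨heV, he3⟩ := mem_powersetCard.1 he
  have hc : (e.erase i).card = 2 := by rw [card_erase_of_mem hie, he3]
  obtain ⟨a, b, hab, hE⟩ := card_eq_two.1 hc
  wlog hlt : a < b generalizing a b
  · exact this b a hab.symm (by rw [hE, pair_comm]) (lt_of_le_of_ne (not_lt.1 hlt) hab.symm)
  have ha : a ∈ e.erase i := by simp [hE]
  have hb : b ∈ e.erase i := by simp [hE]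
  have hai := (mem_erase.1 ha).1
  have hbi := (mem_erase.1 hb).1
  have hak := mem_range.1 (heV (mem_of_mem_erase ha))
  have hbk := mem_range.1 (heV (mem_of_mem_erase hb))
  have heq : e = {a, b, i} := by
    rw [← insert_erase hie, hE]
    ext j
    simp only [mem_insert, mem_singleton]
    tauto
  have h1 : ({0, b, i} : Finset ℕ) ∈ H := by
    rcases eq_or_ne b 1 with rfl | hb1
    · exact hH
    have := h.up _ hH 1 (by simp) b hbk (by simp; omega) (by omega)
    convert this using 1
    ext j
    simp only [mem_insert, mem_singleton, mem_erase]
    omega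
  rw [heq]
  rcases eq_or_ne a 0 with rfl | ha0
  · exact h1
  have := h.up _ h1 0 (by simp) a hak (by simp; omega) (by omega)
  convert this using 1
  ext j
  simp only [mem_insert, mem_singleton, mem_erase]
  omega

/-- The pair 0, 1 lies in some edge, and compression pushes its third vertex to the top. Together
with `mem_of_zero_one_mem` this makes the link of the heaviest vertex complete. -/
theorem zero_one_top_mem (h : IsExtremal m k L H x) (hk : 3 ≤ k) : {0, 1, k - 1} ∈ H := by
  obtain ⟨e, he, h0, h1⟩ := h.exists_edge (u := 0) (v := 1) (by omega) (by omega) (by omega)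
  obtain ⟨heV, he3⟩ := mem_powersetCard.1 (h.subset he)
  have hc : ((e.erase 0).erase 1).card = 1 := by
    rw [card_erase_of_mem (mem_erase.2 ⟨by omega, h1⟩), card_erase_of_mem h0, he3]
  obtain ⟨a, ha⟩ := card_eq_one.1 hc
  have ha' : a ∈ (e.erase 0).erase 1 := by simp [ha]
  simp only [mem_erase] at ha'
  have heq : e = {0, 1, a} := by
    rw [← insert_erase h0, ← insert_erase (mem_erase.2 ⟨by omega, h1⟩ : 1 ∈ e.erase 0), ha]
  have hak := mem_range.1 (heV ha'.2.2)
  rcases eq_or_ne a (k - 1) with rfl | hak'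
  · exact heq ▸ he
  subst heq
  have := h.up _ he a (by simp) (k - 1) (by omega) (by simp; omega) (by omega)
  convert this using 1
  ext j
  simp only [mem_insert, mem_singleton, mem_erase]
  omega

theorem mem_of_top_mem (h : IsExtremal m k L H x) (hk : 3 ≤ k) {e : Finset ℕ}
    (he : e ∈ powersetCard 3 (range k)) (hie : k - 1 ∈ e) : e ∈ H :=
  h.mem_of_zero_one_mem (by omega) (h.zero_one_top_mem hk) he hie

theorem choose_two_le (h : IsExtremal m k L H x) (hk : 3 ≤ k) : (k - 1).choose 2 ≤ m := by
  refine le_trans ?_ h.card_le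
  have := card_filter_mem_powersetCard (mem_range.2 (by omega : k - 1 < k)) 2
  rw [card_range] at this
  rw [← this]
  exact card_le_card fun e he => h.mem_of_top_mem hk (mem_filter.1 he).1 (mem_filter.1 he).2

theorem partialPoly_compl_top (h : IsExtremal m k L H x) (hk : 3 ≤ k) :
    partialPoly (powersetCard 3 (range k) \ H) (k - 1) x = 0 := by
  rw [partialPoly, filter_eq_empty_iff.2, sum_empty]
  intro e he hek
  exact (mem_sdiff.1 he).2 (h.mem_of_top_mem hk (mem_sdiff.1 he).1 hek)

/-- The optimality conditions in terms of the missing edges. -/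
theorem sub_sq_add_partialPoly_compl (h : IsExtremal m k L H x) {u v : ℕ} (hu : u < k)
    (hv : v < k) :
    x u - x u ^ 2 + partialPoly (powersetCard 3 (range k) \ H) u x
      = x v - x v ^ 2 + partialPoly (powersetCard 3 (range k) \ H) v x := by
  have h1 := partialPoly_sdiff_add h.subset u x
  have h2 := partialPoly_sdiff_add h.subset v x
  have h3 := two_mul_partialPoly_powersetCard_three (mem_range.2 hu) h.sum_eq
  have h4 := two_mul_partialPoly_powersetCard_three (mem_range.2 hv) h.sum_eq
  have h5 := h.partialPoly_eq hu hv
  linarith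

/-- With $c$ the top weight, the top derivative equals $3\lambda>6/25$. The link of the top is
complete and $\sum x_i^2\ge c^2$, so this derivative is at most $(1-c)^2/2$, which is too small for
$c>3/8$. -/
theorem top_le (h : IsExtremal m k L H x) (hk : 3 ≤ k) (hL : 2 / 25 ≤ L) : x (k - 1) ≤ 3 / 8 := by
  have hk1 : k - 1 < k := by omega
  have h1 := partialPoly_sdiff_add h.subset (k - 1) x
  have h3 := two_mul_partialPoly_powersetCard_three (mem_range.2 hk1) h.sum_eq
  have h4 := h.partialPoly_eq_three_mul hk1
  have h5 := h.partialPoly_compl_top hk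
  have h6 : x (k - 1) ^ 2 ≤ ∑ i ∈ range k, x i ^ 2 :=
    single_le_sum (f := fun i => x i ^ 2) (fun i _ => sq_nonneg (x i)) (mem_range.2 hk1)
  have h7 := h.lt
  have h8 : x (k - 1) ≤ 1 := h.sum_eq ▸ single_le_sum (fun i _ => h.nonneg i) (mem_range.2 hk1)
  nlinarith

/-- Replace the edges through the lightest vertex by missing edges, after moving its weight. -/
theorem sum_missing_lt (h : IsExtremal m k L H x) (hk : 3 ≤ k) {S : Finset (Finset ℕ)}
    (hS : S ⊆ powersetCard 3 (range k) \ H)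
    (hc : S.card ≤ (H.filter (0 ∈ ·)).card) :
    ∑ e ∈ S, ∏ i ∈ e, shiftWeight x 1 0 (x 0) i < x 0 ^ 2 * codegPoly H 1 0 x := by
  set y := shiftWeight x 1 0 (x 0) with hy
  have hdisj : Disjoint (H.filter (0 ∉ ·)) S :=
    disjoint_left.2 fun e he heS => (mem_sdiff.1 (hS heS)).2 (mem_filter.1 he).1
  have hy0 : y 0 = 0 := by rw [hy, shiftWeight_right x (by norm_num), sub_self]
  have h1 := h.vanish (H.filter (0 ∉ ·) ∪ S)
    (union_subset ((filter_subset _ _).trans h.subset) (hS.trans sdiff_subset)) (by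
      rw [card_union_of_disjoint hdisj]
      have := card_filter_add_card_filter_not (s := H) (fun e => 0 ∈ e)
      have := h.card_le
      omega) y (h.shiftWeight_nonneg (by norm_num) (h.nonneg 0) le_rfl)
    (h.sum_shiftWeight_eq (by omega) (by omega) (by norm_num) _) 0 (by omega) hy0
  have h2 := h.edgePoly_shiftWeight_eq (u := 1) (v := 0) (by omega) (by omega) (by norm_num) (x 0)
  have h3 : edgePoly (H.filter (0 ∉ ·)) y = edgePoly H y := by
    simp only [edgePoly, sum_filter]
    refine sum_congr rfl fun e _ => ?_
    split_ifs with h0e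
    · exact (prod_eq_zero h0e hy0).symm
    · rfl
  rw [edgePoly_union hdisj, h3] at h1
  rw [← hy] at h2
  have h4 : ∑ e ∈ S, ∏ i ∈ e, y i = edgePoly S y := rfl
  linarith [h.lt]

end IsExtremal

/-! ### More vertices than needed: deleting the lightest vertex -/

theorem codegPoly_one_zero {k : ℕ} {G : Finset (Finset ℕ)} (hG : G ⊆ powersetCard 3 (range k))
    (x : ℕ → ℝ) :
    codegPoly G 1 0 x = ∑ i ∈ range k with 2 ≤ i ∧ {0, 1, i} ∈ G, x i := by
  have hE : ∀ i, 2 ≤ i → ((({0, 1, i} : Finset ℕ).erase 1).erase 0) = {i} := by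
    intro i hi
    ext j
    simp only [mem_erase, mem_insert, mem_singleton]
    omega
  symm
  refine sum_nbij (fun i => {0, 1, i}) ?_ ?_ ?_ ?_
  · intro i hi
    exact mem_filter.2 ⟨(mem_filter.1 hi).2.2, by simp⟩
  · intro i hi j hj hij
    have h1 := hE i (mem_filter.1 hi).2.1
    have hij : ({0, 1, i} : Finset ℕ) = {0, 1, j} := hij
    rw [hij, hE j (mem_filter.1 hj).2.1] at h1
    exact (singleton_injective h1).symm
  · intro e he
    obtain ⟨heG, h1, h0⟩ := mem_filter.1 he
    obtain ⟨heV, he3⟩ := mem_powersetCard.1 (hG heG)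
    have h1' : 1 ∈ e.erase 0 := mem_erase.2 ⟨by norm_num, h1⟩
    have hc : ((e.erase 0).erase 1).card = 1 := by
      rw [card_erase_of_mem h1', card_erase_of_mem h0, he3]
    obtain ⟨a, ha⟩ := card_eq_one.1 hc
    have heq : e = {0, 1, a} := by rw [← insert_erase h0, ← insert_erase h1', ha]
    have ha' : a ∈ (e.erase 0).erase 1 := by simp [ha]
    simp only [mem_erase] at ha'
    exact ⟨a, mem_filter.2 ⟨heV ha'.2.2, by omega, heq ▸ heG⟩, heq.symm⟩
  · intro i hi
    rw [hE i (mem_filter.1 hi).2.1, prod_singleton]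

namespace IsExtremal

variable {m k : ℕ} {L : ℝ} {H : Finset (Finset ℕ)} {x : ℕ → ℝ}

theorem card_add_two_le (hk : 2 ≤ k) {B : Finset ℕ}
    (hB : B = (range k).filter fun i => 2 ≤ i ∧ {0, 1, i} ∈ H) : B.card + 2 ≤ k := by
  have hsub : B ⊆ ((range k).erase 0).erase 1 := by
    intro i hi
    rw [hB, mem_filter] at hi
    exact mem_erase.2 ⟨by omega, mem_erase.2 ⟨by omega, hi.1⟩⟩
  have := card_le_card hsub
  rw [card_erase_of_mem (by simp; omega), card_erase_of_mem (by simp; omega), card_range] at this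
  omega

/-- Every triple meeting `B` is an edge, so with $b=|B|$ the degree of 0 is at least
$\binom{k-1}2-\binom{k-1-b}2$. -/
theorem card_zero_mem_lower (h : IsExtremal m k L H x) (hk : 3 ≤ k) {B : Finset ℕ}
    (hB : B = (range k).filter fun i => 2 ≤ i ∧ {0, 1, i} ∈ H) :
    (B.card : ℝ) * (2 * k - 3 - B.card) ≤ 2 * ((H.filter (0 ∈ ·)).card : ℝ) := by
  have hBV : B ⊆ range k := hB ▸ filter_subset _ _
  have hBlt := card_add_two_le (by omega) hB
  have h0 : 0 ∈ range k \ B := by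
    rw [hB]
    simp
    omega
  have h1 := card_filter_mem_powersetCard (mem_range.2 (by omega : 0 < k)) 2
  have h2 := card_filter_mem_powersetCard h0 2
  rw [card_range] at h1
  rw [card_sdiff_of_subset hBV, card_range] at h2
  have hsub : (powersetCard 3 (range k)).filter (0 ∈ ·)
      ⊆ H.filter (0 ∈ ·) ∪ (powersetCard 3 (range k \ B)).filter (0 ∈ ·) := by
    intro e he
    obtain ⟨heT, h0e⟩ := mem_filter.1 he
    obtain ⟨heV, he3⟩ := mem_powersetCard.1 heT
    by_cases hd : ∃ i ∈ e, i ∈ B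
    · obtain ⟨i, hie, hiB⟩ := hd
      rw [hB, mem_filter] at hiB
      exact mem_union_left _ (mem_filter.2
        ⟨h.mem_of_zero_one_mem hiB.2.1 hiB.2.2 heT hie, h0e⟩)
    · push Not at hd
      refine mem_union_right _ (mem_filter.2 ⟨mem_powersetCard.2 ⟨fun i hi => ?_, he3⟩, h0e⟩)
      exact mem_sdiff.2 ⟨heV hi, hd i hi⟩
  have h3 := (card_le_card hsub).trans (card_union_le _ _)
  rw [h1, h2] at h3
  have h4 : ((k - 1).choose 2 : ℝ) ≤ (H.filter (0 ∈ ·)).card + ((k - B.card - 1).choose 2 : ℕ) := by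
    exact_mod_cast h3
  rw [Nat.cast_choose_two, Nat.cast_choose_two, Nat.cast_sub (by omega), Nat.cast_sub (by omega),
    Nat.cast_sub (by omega)] at h4
  push_cast at h4
  nlinarith

/-- Missing triples avoid `B`, so those through 1 but not 0 number at most $\binom{k-2-b}2$. -/
theorem card_missing_one_mem_upper (h : IsExtremal m k L H x) (hk : 3 ≤ k) {B : Finset ℕ}
    (hB : B = (range k).filter fun i => 2 ≤ i ∧ {0, 1, i} ∈ H) :
    2 * ((((powersetCard 3 (range k) \ H).filter (1 ∈ ·)).filter (0 ∉ ·)).card : ℝ)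
      ≤ (k - 2 - B.card) * (k - 3 - B.card) := by
  have hBV : B ⊆ range k := hB ▸ filter_subset _ _
  have hBlt := card_add_two_le (by omega) hB
  have h0 : 0 ∈ range k \ B := by
    rw [hB]
    simp
    omega
  have h1 : 1 ∈ (range k \ B).erase 0 := by
    rw [hB]
    simp
    omega
  have h2 := card_filter_mem_powersetCard h1 2
  rw [card_erase_of_mem h0, card_sdiff_of_subset hBV, card_range] at h2
  have hsub : ((powersetCard 3 (range k) \ H).filter (1 ∈ ·)).filter (0 ∉ ·)
      ⊆ (powersetCard 3 ((range k \ B).erase 0)).filter (1 ∈ ·) := by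
    intro e he
    simp only [mem_filter, mem_sdiff] at he
    obtain ⟨⟨⟨heT, heH⟩, h1e⟩, h0e⟩ := he
    obtain ⟨heV, he3⟩ := mem_powersetCard.1 heT
    refine mem_filter.2 ⟨mem_powersetCard.2 ⟨fun i hi => ?_, he3⟩, h1e⟩
    refine mem_erase.2 ⟨ne_of_mem_of_not_mem hi h0e, mem_sdiff.2 ⟨heV hi, fun hiB => ?_⟩⟩
    rw [hB, mem_filter] at hiB
    exact heH (h.mem_of_zero_one_mem hiB.2.1 hiB.2.2 heT hi)
  have h3 := card_le_card hsub
  rw [h2] at h3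
  have h4 : ((((powersetCard 3 (range k) \ H).filter (1 ∈ ·)).filter (0 ∉ ·)).card : ℝ)
      ≤ ((k - B.card - 1 - 1).choose 2 : ℕ) := by
    exact_mod_cast h3
  rw [Nat.cast_choose_two, Nat.cast_sub (by omega), Nat.cast_sub (by omega),
    Nat.cast_sub (by omega)] at h4
  push_cast at h4
  nlinarith

/-- Comparing the optimality conditions at 1 and at the top, where nothing is missing, gives the
missing derivative at 1 as $(c-x_1)(1-c-x_1)$ with $c=x_{k-1}$. The triples through 0 account for at
most $x_0(1-c-x_1)$ of it. -/
theorem weight_missing_one_mem_lower (h : IsExtremal m k L H x) (hk : 3 ≤ k) :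
    (x (k - 1) - x 1 - x 0) * (1 - x (k - 1) - x 1)
      ≤ ∑ e ∈ ((powersetCard 3 (range k) \ H).filter (1 ∈ ·)).filter (0 ∉ ·),
        ∏ i ∈ e.erase 1, x i := by
  set U := powersetCard 3 (range k) \ H with hU
  have h1 := h.sub_sq_add_partialPoly_compl (u := 1) (v := k - 1) (by omega) (by omega)
  rw [h.partialPoly_compl_top hk, ← hU] at h1
  have h2 : partialPoly U 1 x = ∑ e ∈ (U.filter (1 ∈ ·)).filter (0 ∉ ·), ∏ i ∈ e.erase 1, x i
      + x 0 * codegPoly U 1 0 x := by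
    rw [partialPoly, ← sum_filter_add_sum_filter_not _ (fun e => 0 ∈ e), add_comm, codegPoly,
      filter_filter (fun e => 1 ∈ e) (fun e => 0 ∈ e), mul_sum]
    congr 1
    refine sum_congr rfl fun e he => ?_
    have he := (mem_filter.1 he).2
    rw [mul_prod_erase _ x (mem_erase.2 ⟨by norm_num, he.2⟩ : 0 ∈ e.erase 1)]
  have h3 : codegPoly U 1 0 x ≤ 1 - x (k - 1) - x 1 := by
    rw [codegPoly_one_zero sdiff_subset]
    have hs := h.sum_eq
    rw [← add_sum_erase _ _ (mem_range.2 (by omega : k - 1 < k)),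
      ← add_sum_erase _ _ (mem_erase.2 ⟨by omega, mem_range.2 (by omega)⟩ :
        1 ∈ (range k).erase (k - 1))] at hs
    have : ∑ i ∈ range k with 2 ≤ i ∧ {0, 1, i} ∈ U, x i
        ≤ ∑ i ∈ ((range k).erase (k - 1)).erase 1, x i := by
      refine sum_le_sum_of_subset_of_nonneg (fun i hi => ?_) fun i _ _ => h.nonneg i
      simp only [mem_filter, hU, mem_sdiff] at hi
      refine mem_erase.2 ⟨by omega, mem_erase.2 ⟨?_, hi.1⟩⟩
      rintro rfl
      exact hi.2.2.2 (h.zero_one_top_mem hk)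
    linarith
  have h4 := mul_le_mul_of_nonneg_left h3 (h.nonneg 0)
  nlinarith

/-- As $m\le\binom{k-1}3$, the $d$ edges through 0 can be traded for $d$ missing triples avoiding 0,
each of weight at least $x_1^3$. Hence $dx_1^3<x_0^2bc$ with $c$ the top weight, while $d\ge
b(k-1)/2$. -/
theorem two_top_lt (h : IsExtremal m k L H x) (hk : 7 ≤ k) (hm : m ≤ (k - 1).choose 3)
    {B : Finset ℕ} (hB : B = (range k).filter fun i => 2 ≤ i ∧ {0, 1, i} ∈ H)
    (hb : 1 ≤ B.card) (hBk : B.card + 2 ≤ k)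
    (hC : codegPoly H 1 0 x ≤ B.card * x (k - 1)) :
    x 1 * (k - 1) < 2 * x (k - 1) := by
  have hd := h.card_zero_mem_lower (by omega) hB
  set d := (H.filter (0 ∈ ·)).card with hdd
  have hmis : d ≤ (powersetCard 3 ((range k).erase 0) \ H).card := by
    have h1 : powersetCard 3 ((range k).erase 0)
        ⊆ (powersetCard 3 ((range k).erase 0) \ H) ∪ H.filter (0 ∉ ·) := by
      intro e he
      by_cases heH : e ∈ H
      · refine mem_union_right _ (mem_filter.2 ⟨heH, fun h0 => ?_⟩)
        simpa using (mem_powersetCard.1 he).1 h0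
      · exact mem_union_left _ (mem_sdiff.2 ⟨he, heH⟩)
    have h2 := (card_le_card h1).trans (card_union_le _ _)
    rw [card_powersetCard, card_erase_of_mem (mem_range.2 (by omega)), card_range] at h2
    have := card_filter_add_card_filter_not (s := H) (fun e => 0 ∈ e)
    have := h.card_le
    omega
  obtain ⟨S, hS, hSd⟩ := exists_subset_card_eq hmis
  have hS0 : ∀ e ∈ S, 0 ∉ e := fun e he h0 => by
    simpa using (mem_powersetCard.1 (mem_sdiff.1 (hS he)).1).1 h0
  have hST : S ⊆ powersetCard 3 (range k) \ H := fun e he => by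
    obtain ⟨h1, h2⟩ := mem_sdiff.1 (hS he)
    exact mem_sdiff.2 ⟨powersetCard_mono (erase_subset _ _) h1, h2⟩
  have h1 := h.sum_missing_lt (by omega) hST hSd.le
  have h2 : (d : ℝ) * x 1 ^ 3 ≤ ∑ e ∈ S, ∏ i ∈ e, shiftWeight x 1 0 (x 0) i := by
    rw [← hSd, ← nsmul_eq_mul]
    refine card_nsmul_le_sum S _ _ fun e he => ?_
    obtain ⟨heV, he3⟩ := mem_powersetCard.1 (mem_sdiff.1 (hST he)).1
    rw [← he3, ← prod_const]
    refine prod_le_prod (fun i _ => h.nonneg 1) fun i hi => ?_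
    have hi0 : i ≠ 0 := ne_of_mem_of_not_mem hi (hS0 e he)
    rcases eq_or_ne i 1 with rfl | hi1
    · rw [shiftWeight_left]
      linarith [h.nonneg 0]
    · rw [shiftWeight_of_ne x hi1 hi0]
      exact h.mono 1 i (by omega) (mem_range.1 (heV hi))
  by_contra! hge
  have hv := h.pos (by omega : 0 < k)
  have hvu := h.mono 0 1 (by omega) (by omega)
  have hbr : (1 : ℝ) ≤ B.card := by exact_mod_cast hb
  have hkr : (B.card : ℝ) + 2 ≤ k := by exact_mod_cast hBk
  have h3 : (B.card : ℝ) * x (k - 1) ≤ d * x 1 := by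
    have h4 : (B.card : ℝ) * (k - 1) ≤ 2 * d :=
      le_trans (mul_le_mul_of_nonneg_left (by linarith) (by linarith)) hd
    have h5 := mul_le_mul_of_nonneg_right h4 (h.nonneg 1)
    have h6 := mul_le_mul_of_nonneg_left hge (by linarith : (0 : ℝ) ≤ B.card)
    linarith
  have h4 : x 0 ^ 2 * codegPoly H 1 0 x ≤ x 1 ^ 2 * (d * x 1) :=
    mul_le_mul (pow_le_pow_left₀ hv.le hvu 2) (hC.trans h3)
      (sum_nonneg fun _ _ => prod_nonneg fun i _ => h.nonneg i) (by positivity)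
  linarith [show x 1 ^ 2 * (d * x 1) = (d : ℝ) * x 1 ^ 3 by ring]

/-- The missing triples traded in are those through 1 but not 0. The optimality conditions force
them to carry much weight, and 1 has just received the weight of 0. If there are more than $d$ of
them, an above-average choice of $d$ is used. -/
theorem false_of_le_choose (h : IsExtremal m k L H x) (hk : 7 ≤ k) (hm : m ≤ (k - 1).choose 3)
    (hL : 2 / 25 ≤ L) : False := by
  obtain ⟨B, hB⟩ : ∃ B, B = (range k).filter fun i => 2 ≤ i ∧ {0, 1, i} ∈ H := ⟨_, rfl⟩
  have hb : 1 ≤ B.card := by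
    refine card_pos.2 ⟨k - 1, ?_⟩
    rw [hB]
    exact mem_filter.2 ⟨mem_range.2 (by omega), by omega, h.zero_one_top_mem (by omega)⟩
  have hBk := card_add_two_le (by omega) hB
  have hCB : codegPoly H 1 0 x = ∑ i ∈ B, x i := by rw [codegPoly_one_zero h.subset, hB]
  have hC1 : codegPoly H 1 0 x ≤ 1 := by
    rw [hCB, ← h.sum_eq]
    exact sum_le_sum_of_subset_of_nonneg (hB ▸ filter_subset _ _) fun i _ _ => h.nonneg i
  have hC2 : codegPoly H 1 0 x ≤ B.card * x (k - 1) := by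
    rw [hCB, ← nsmul_eq_mul]
    refine sum_le_card_nsmul B _ _ fun i hi => ?_
    rw [hB, mem_filter, mem_range] at hi
    exact h.mono i (k - 1) (by omega) (by omega)
  have hu := h.two_top_lt hk hm hB hb hBk hC2
  have hc := h.top_le (by omega) hL
  have hd := h.card_zero_mem_lower (by omega) hB
  have hN := h.card_missing_one_mem_upper (by omega) hB
  have hP := h.weight_missing_one_mem_lower (by omega)
  have hv := h.pos (by omega : 0 < k)
  have hvu := h.mono 0 1 (by omega) (by omega)
  have hkr : (7 : ℝ) ≤ k := by exact_mod_cast hk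
  -- This is where $k\ge7$ enters: $6x_1\le(k-1)x_1<2c$.
  have huc : 3 * x 1 ≤ x (k - 1) := by nlinarith [h.nonneg 1]
  have hvk : (k - 1) * x 0 ≤ 1 - x (k - 1) := by
    have hs := h.sum_eq
    rw [← add_sum_erase _ _ (mem_range.2 (by omega : k - 1 < k))] at hs
    have := card_nsmul_le_sum ((range k).erase (k - 1)) x (x 0) fun i hi =>
      h.mono 0 i (by omega) (mem_range.1 (mem_of_mem_erase hi))
    rw [card_erase_of_mem (mem_range.2 (by omega)), card_range, nsmul_eq_mul,
      Nat.cast_sub (by omega)] at this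
    push_cast at this
    linarith
  set d := (H.filter (0 ∈ ·)).card with hdd
  set S₀ := ((powersetCard 3 (range k) \ H).filter (1 ∈ ·)).filter (0 ∉ ·) with hS₀
  have hsub : S₀ ⊆ powersetCard 3 (range k) \ H :=
    (filter_subset _ _).trans (filter_subset _ _)
  have h0 : ∀ e ∈ S₀, 0 ∉ e := fun e he => (mem_filter.1 he).2
  set P := ∑ e ∈ S₀, ∏ i ∈ e.erase 1, x i with hPdef
  have hsum : ∑ e ∈ S₀, ∏ i ∈ e, shiftWeight x 1 0 (x 0) i = (x 1 + x 0) * P := by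
    rw [hPdef, mul_sum]
    refine sum_congr rfl fun e he => ?_
    have h1e := (mem_filter.1 (mem_filter.1 he).1).2
    rw [← mul_prod_erase e _ h1e, shiftWeight_left, prod_shiftWeight_of_notMem]
    · simp
    · exact fun h => h0 e he (mem_of_mem_erase h)
  set c := x (k - 1) with hcdef
  have hPc : c / 3 * (1 - 4 / 3 * c) ≤ P :=
    le_trans (mul_le_mul (by linarith) (by linarith) (by linarith) (by linarith)) hP
  have hPgain : 2 * x 0 * (c / 3 * (1 - 4 / 3 * c)) ≤ (x 1 + x 0) * P :=
    mul_le_mul (by linarith) hPc (mul_nonneg (by linarith) (by linarith)) (by linarith)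
  rcases le_or_gt S₀.card d with hle | hlt
  · have h1 := h.sum_missing_lt (by omega) hsub hle
    rw [hsum] at h1
    have h2 := mul_le_mul_of_nonneg_left hC1 (sq_nonneg (x 0))
    have h3 : x 0 * x 0 ≤ x 0 * (c / 3) := mul_le_mul_of_nonneg_left (by linarith) hv.le
    have h4 : x 0 * (c / 3) * (1 / 2) ≤ x 0 * (c / 3) * (1 - 4 / 3 * c) :=
      mul_le_mul_of_nonneg_left (by linarith) (mul_nonneg hv.le (by linarith))
    linarith
  · obtain ⟨S, hS, hSd, hSsum⟩ := exists_subset_card_mul_sum_le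
      (fun e => ∏ i ∈ e, shiftWeight x 1 0 (x 0) i) d S₀ hlt.le
    have h1 := h.sum_missing_lt (by omega) (hS.trans hsub) hSd.le
    rw [hsum] at hSsum
    set W := ∑ e ∈ S, ∏ i ∈ e, shiftWeight x 1 0 (x 0) i with hW
    set b : ℝ := (B.card : ℝ) with hbdef
    set n : ℝ := (S₀.card : ℝ) with hndef
    have hbr : 1 ≤ b := by rw [hbdef]; exact_mod_cast hb
    have hbk : b + 2 ≤ k := by rw [hbdef]; exact_mod_cast hBk
    have hn0 : 0 < n := by
      rw [hndef]
      exact_mod_cast lt_of_le_of_lt (Nat.zero_le d) hlt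
    -- Follows from $2d\ge b(2k-3-b)$ and $2n\le(k-2-b)(k-3-b)$. It bounds the fraction of weight
    -- lost by keeping only $d$ of the $n$ triples.
    have hdn : 2 * b * n ≤ d * (k - 4) := by
      have h2 := mul_le_mul_of_nonneg_left hN (by linarith : 0 ≤ b)
      have h3 := mul_le_mul_of_nonneg_right hd (by linarith : (0 : ℝ) ≤ k - 4)
      have h4 : b * ((k - 2 - b) * (k - 3 - b)) ≤ b * ((2 * k - 3 - b) / 2 * (k - 4)) := by
        refine mul_le_mul_of_nonneg_left ?_ (by linarith)
        rcases le_or_gt 0 ((k : ℝ) - 3 - b) with h5 | h5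
        · exact mul_le_mul (by linarith) (by linarith) h5 (by linarith)
        · refine le_trans (mul_nonpos_of_nonneg_of_nonpos (by linarith) h5.le) ?_
          exact mul_nonneg (by linarith) (by linarith)
      nlinarith
    have h2 : (k - 4) * (d * ((x 1 + x 0) * P)) ≤ (k - 4) * (n * W) :=
      mul_le_mul_of_nonneg_left hSsum (by linarith)
    have h3 : 2 * b * n * (2 * x 0 * (c / 3 * (1 - 4 / 3 * c)))
        ≤ (d * (k - 4)) * ((x 1 + x 0) * P) :=
      mul_le_mul hdn hPgain (by
        refine mul_nonneg (by linarith) (mul_nonneg (by linarith) (by linarith))) (by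
        exact mul_nonneg (Nat.cast_nonneg d) (by linarith))
    have h4 : W < x 0 ^ 2 * (b * c) :=
      h1.trans_le (mul_le_mul_of_nonneg_left hC2 (sq_nonneg _))
    have h5 : n * ((k - 4) * W) < n * ((k - 4) * (x 0 ^ 2 * (b * c))) :=
      mul_lt_mul_of_pos_left (mul_lt_mul_of_pos_left h4 (by linarith)) hn0
    have hc0 : 0 < c := by linarith
    have hpos : 0 < n * (b * (x 0 * c)) := by positivity
    have h6 : n * (b * (x 0 * c)) * (4 / 3 * (1 - 4 / 3 * c))
        < n * (b * (x 0 * c)) * ((k - 4) * x 0) := by linarith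
    -- What remains is $\frac43(1-\frac43c)<(k-4)x_0\le1-c$, hence $c>3/7$, against $c\le3/8$.
    have h7 := lt_of_mul_lt_mul_left h6 hpos.le
    linarith

end IsExtremal

theorem LagrangianBound.succ_of_lt_choose {m k : ℕ} {L : ℝ} (h : LagrangianBound m k L)
    (hk : 2 ≤ k) (hm : m < k.choose 2) : LagrangianBound m (k + 1) L := by
  by_contra hn
  obtain ⟨H, x, hx⟩ := exists_isExtremal h hn
  have := hx.choose_two_le (by omega)
  simp only [Nat.add_sub_cancel] at this
  omega

theorem LagrangianBound.succ_of_le_choose {m k : ℕ} {L : ℝ} (h : LagrangianBound m k L)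
    (hk : 6 ≤ k) (hm : m ≤ k.choose 3) (hL : 2 / 25 ≤ L) : LagrangianBound m (k + 1) L := by
  by_contra hn
  obtain ⟨H, x, hx⟩ := exists_isExtremal h hn
  exact hx.false_of_le_choose (by omega) (by simpa using hm) hL

/-! ### Stars through a pair and small shifted systems -/

/-- The first `d` triples through the pair `{0, 1}`. -/
def pairStar (d : ℕ) : Finset (Finset ℕ) := (range d).image fun i => {0, 1, i + 2}

theorem mem_pairStar {d : ℕ} {e : Finset ℕ} :
    e ∈ pairStar d ↔ ∃ i < d, e = {0, 1, i + 2} := by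
  simp [pairStar, eq_comm]

theorem pairStar_injective : Function.Injective fun i : ℕ => ({0, 1, i + 2} : Finset ℕ) := by
  intro i j hij
  have hij : ({0, 1, i + 2} : Finset ℕ) = {0, 1, j + 2} := hij
  have : i + 2 ∈ ({0, 1, j + 2} : Finset ℕ) := by simp [← hij]
  simpa using this

theorem card_pairStar (d : ℕ) : (pairStar d).card = d := by
  rw [pairStar, card_image_of_injective _ pairStar_injective, card_range]

theorem notMem_pairStar_of_zero_notMem {d : ℕ} {e : Finset ℕ} (h : 0 ∉ e) : e ∉ pairStar d := by
  rw [mem_pairStar]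
  rintro ⟨i, -, rfl⟩
  simp at h

theorem notMem_pairStar_of_one_notMem {d : ℕ} {e : Finset ℕ} (h : 1 ∉ e) : e ∉ pairStar d := by
  rw [mem_pairStar]
  rintro ⟨i, -, rfl⟩
  simp at h

theorem pairStar_subset {d k : ℕ} (h : d + 2 ≤ k) : pairStar d ⊆ powersetCard 3 (range k) := by
  intro e he
  obtain ⟨i, hi, rfl⟩ := mem_pairStar.1 he
  refine mem_powersetCard.2 ⟨?_, ?_⟩
  · intro j hj
    simp only [mem_insert, mem_singleton] at hj
    exact mem_range.2 (by omega)
  · rw [card_eq_three]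
    exact ⟨0, 1, i + 2, by omega, by omega, by omega, rfl⟩

theorem edgePoly_pairStar (d : ℕ) (x : ℕ → ℝ) :
    edgePoly (pairStar d) x = x 0 * x 1 * ∑ i ∈ range d, x (i + 2) := by
  rw [edgePoly, pairStar, sum_image pairStar_injective.injOn, mul_sum]
  refine sum_congr rfl fun i _ => ?_
  rw [prod_insert (by simp), prod_insert (by simp), prod_singleton]
  ring

theorem partialPoly_pairStar (d w : ℕ) (x : ℕ → ℝ) :
    partialPoly (pairStar d) w x = ∑ i ∈ range d,
      if w ∈ ({0, 1, i + 2} : Finset ℕ) then ∏ j ∈ ({0, 1, i + 2} : Finset ℕ).erase w, x j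
        else 0 := by
  rw [partialPoly, sum_filter, pairStar, sum_image pairStar_injective.injOn]

theorem partialPoly_pairStar_zero (d : ℕ) (x : ℕ → ℝ) :
    partialPoly (pairStar d) 0 x = x 1 * ∑ i ∈ range d, x (i + 2) := by
  rw [partialPoly_pairStar, mul_sum]
  refine sum_congr rfl fun i _ => ?_
  rw [if_pos (by simp), erase_insert (by simp), prod_insert (by simp), prod_singleton]

theorem partialPoly_pairStar_one (d : ℕ) (x : ℕ → ℝ) :
    partialPoly (pairStar d) 1 x = x 0 * ∑ i ∈ range d, x (i + 2) := by
  rw [partialPoly_pairStar, mul_sum]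
  refine sum_congr rfl fun i _ => ?_
  rw [if_pos (by simp), insert_comm, erase_insert (by simp), prod_insert (by simp),
    prod_singleton]

theorem partialPoly_pairStar_of_lt {d w : ℕ} (h2 : 2 ≤ w) (h : w < d + 2) (x : ℕ → ℝ) :
    partialPoly (pairStar d) w x = x 0 * x 1 := by
  rw [partialPoly_pairStar, sum_eq_single (w - 2)]
  · have hw : w - 2 + 2 = w := by omega
    rw [hw, if_pos (by simp)]
    have : ({0, 1, w} : Finset ℕ).erase w = {0, 1} := by
      ext j
      simp only [mem_erase, mem_insert, mem_singleton]
      omega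
    rw [this, prod_insert (by simp), prod_singleton]
  · intro i _ hi
    refine if_neg ?_
    simp only [mem_insert, mem_singleton]
    omega
  · intro hn
    exact absurd (mem_range.2 (by omega)) hn

theorem partialPoly_pairStar_of_ge {d w : ℕ} (h : d + 2 ≤ w) (x : ℕ → ℝ) :
    partialPoly (pairStar d) w x = 0 := by
  rw [partialPoly_pairStar]
  refine sum_eq_zero fun i hi => if_neg ?_
  have := mem_range.1 hi
  simp only [mem_insert, mem_singleton]
  omega

theorem exists_lt_lt_of_card_eq_three {e : Finset ℕ} (he : e.card = 3) :
    ∃ a b c, a < b ∧ b < c ∧ e = {a, b, c} := by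
  have hne : e.Nonempty := card_pos.1 (by omega)
  have h1 : (e.erase (e.min' hne)).card = 2 := by rw [card_erase_of_mem (min'_mem _ _), he]
  obtain ⟨b, c, hbc, hE⟩ := card_eq_two.1 h1
  wlog hlt : b < c generalizing b c
  · exact this c b hbc.symm (by rw [hE, pair_comm]) (lt_of_le_of_ne (not_lt.1 hlt) hbc.symm)
  have hb : b ∈ e.erase (e.min' hne) := by simp [hE]
  refine ⟨e.min' hne, b, c, ?_, hlt, ?_⟩
  · exact lt_of_le_of_ne (min'_le _ _ (mem_of_mem_erase hb)) (mem_erase.1 hb).1.symm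
  · rw [← hE, insert_erase (min'_mem _ _)]

/-- A set system is closed under replacing an element of a member by a smaller one. -/
def IsShifted (U : Finset (Finset ℕ)) : Prop :=
  ∀ e ∈ U, ∀ i ∈ e, ∀ j ∉ e, j < i → insert j (e.erase i) ∈ U

/-- Lowering the entries one at a time, the smallest first, keeps the three of them distinct. -/
theorem IsShifted.mem_of_le {U : Finset (Finset ℕ)} (hU : IsShifted U) {a b c a' b' c' : ℕ}
    (h : {a, b, c} ∈ U) (hab : a < b) (hbc : b < c) (hab' : a' < b') (hbc' : b' < c')
    (ha : a' ≤ a) (hb : b' ≤ b) (hc : c' ≤ c) : {a', b', c'} ∈ U := by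
  have h1 : {a', b, c} ∈ U := by
    rcases ha.eq_or_lt with rfl | hlt
    · exact h
    convert hU _ h a (by simp) a' (by simp; omega) hlt using 1
    ext j
    simp only [mem_insert, mem_singleton, mem_erase]
    omega
  have h2 : {a', b', c} ∈ U := by
    rcases hb.eq_or_lt with rfl | hlt
    · exact h1
    convert hU _ h1 b (by simp) b' (by simp; omega) hlt using 1
    ext j
    simp only [mem_insert, mem_singleton, mem_erase]
    omega
  rcases hc.eq_or_lt with rfl | hlt
  · exact h2
  convert hU _ h2 c (by simp) c' (by simp; omega) hlt using 1
  ext j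
  simp only [mem_insert, mem_singleton, mem_erase]
  omega

/-- The shifted systems of at most six triples. -/
theorem IsShifted.classification {U : Finset (Finset ℕ)} (hU : IsShifted U)
    (h3 : ∀ e ∈ U, e.card = 3) (h6 : U.card ≤ 6) :
    ∃ d, U = pairStar d ∨ (2 ≤ d ∧ U = insert {0, 2, 3} (pairStar d)) ∨
      (3 ≤ d ∧ U = insert {0, 2, 4} (insert {0, 2, 3} (pairStar d))) ∨
      (2 ≤ d ∧ U = insert {1, 2, 3} (insert {0, 2, 3} (pairStar d))) ∨
      (d = 3 ∧ U = insert {0, 2, 4} (insert {1, 2, 3} (insert {0, 2, 3} (pairStar d)))) ∨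
      (d = 3 ∧ U = insert {0, 3, 4} (insert {0, 2, 4} (insert {0, 2, 3} (pairStar d)))) := by
  have hseven : ∀ S : Finset (Finset ℕ), S.card = 7 → ¬ S ⊆ U := fun S hS h => by
    have := card_le_card h
    omega
  have hex : ∃ d, ({0, 1, d + 2} : Finset ℕ) ∉ U := by
    by_contra! hn
    refine hseven _ (card_pairStar 7) fun e he => ?_
    obtain ⟨i, -, rfl⟩ := mem_pairStar.1 he
    exact hn i
  obtain ⟨d, hd, hdmin⟩ : ∃ d, ({0, 1, d + 2} : Finset ℕ) ∉ U ∧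
      ∀ i < d, ({0, 1, i + 2} : Finset ℕ) ∈ U :=
    ⟨Nat.find hex, Nat.find_spec hex, fun i hi => not_not.1 (Nat.find_min hex hi)⟩
  have hstar : ∀ i, ({0, 1, i + 2} : Finset ℕ) ∈ U → i < d := fun i hi => by
    by_contra hid
    exact hd (hU.mem_of_le hi (by omega) (by omega) (by omega) (by omega) le_rfl le_rfl (by omega))
  have hsub : pairStar d ⊆ U := fun e he => by
    obtain ⟨i, hi, rfl⟩ := mem_pairStar.1 he
    exact hdmin i hi
  have hform : ∀ e ∈ U, e ∈ pairStar d ∨ e = {0, 2, 3} ∨ e = {0, 2, 4} ∨ e = {0, 3, 4} ∨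
      e = {1, 2, 3} := by
    intro e he
    obtain ⟨a, b, c, hab, hbc, rfl⟩ := exists_lt_lt_of_card_eq_three (h3 e he)
    have hle := fun (a' b' c' : ℕ) (h1 : a' < b') (h2 : b' < c') =>
      hU.mem_of_le (a' := a') (b' := b') (c' := c') he hab hbc h1 h2
    by_cases hs : a = 0 ∧ b = 1
    · obtain ⟨rfl, rfl⟩ := hs
      obtain ⟨i, rfl⟩ : ∃ i, c = i + 2 := ⟨c - 2, by omega⟩
      exact Or.inl (mem_pairStar.2 ⟨i, hstar i he, rfl⟩)
    right
    -- Outside the star, such a triple dominates $\{0,2,5\}$, which already has seven triples at or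
    -- below it.
    by_cases hc : 5 ≤ c
    · refine absurd ?_ (hseven
        {{0, 1, 2}, {0, 1, 3}, {0, 1, 4}, {0, 1, 5}, {0, 2, 3}, {0, 2, 4}, {0, 2, 5}}
        (by decide))
      simp only [insert_subset_iff, singleton_subset_iff]
      refine ⟨?_, ?_, ?_, ?_, ?_, ?_, ?_⟩ <;> apply hle <;> omega
    -- Here the triple dominates $\{1,2,4\}$, again with seven triples at or below it.
    by_cases ha : 1 ≤ a ∧ c = 4
    · refine absurd ?_ (hseven
        {{0, 1, 2}, {0, 1, 3}, {0, 1, 4}, {0, 2, 3}, {0, 2, 4}, {1, 2, 3}, {1, 2, 4}}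
        (by decide))
      simp only [insert_subset_iff, singleton_subset_iff]
      refine ⟨?_, ?_, ?_, ?_, ?_, ?_, ?_⟩ <;> apply hle <;> omega
    obtain ⟨rfl, rfl, rfl⟩ | ⟨rfl, rfl, rfl⟩ | ⟨rfl, rfl, rfl⟩ | ⟨rfl, rfl, rfl⟩ :
      (a = 0 ∧ b = 2 ∧ c = 3) ∨ (a = 0 ∧ b = 2 ∧ c = 4) ∨ (a = 0 ∧ b = 3 ∧ c = 4) ∨
      (a = 1 ∧ b = 2 ∧ c = 3) := by omega
    all_goals simp
  have hle := fun (a b c a' b' c' : ℕ) (he : {a, b, c} ∈ U) (hab : a < b) (hbc : b < c)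
      (h1 : a' < b') (h2 : b' < c') =>
    hU.mem_of_le (a' := a') (b' := b') (c' := c') he hab hbc h1 h2
  refine ⟨d, ?_⟩
  have hcl1 : ({0, 2, 3} : Finset ℕ) ∈ U → 2 ≤ d := fun h =>
    hstar 1 (hle 0 2 3 0 1 3 h (by omega) (by omega) (by omega) (by omega) (by omega) (by omega)
      (by omega))
  have hcl2 : ({0, 2, 4} : Finset ℕ) ∈ U → 3 ≤ d ∧ {0, 2, 3} ∈ U := fun h =>
    ⟨hstar 2 (hle 0 2 4 0 1 4 h (by omega) (by omega) (by omega) (by omega) (by omega) (by omega)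
      (by omega)), hle 0 2 4 0 2 3 h (by omega) (by omega) (by omega) (by omega) (by omega)
      (by omega) (by omega)⟩
  have hcl3 : ({0, 3, 4} : Finset ℕ) ∈ U → {0, 2, 4} ∈ U := fun h =>
    hle 0 3 4 0 2 4 h (by omega) (by omega) (by omega) (by omega) (by omega) (by omega) (by omega)
  have hcl4 : ({1, 2, 3} : Finset ℕ) ∈ U → {0, 2, 3} ∈ U := fun h =>
    hle 1 2 3 0 2 3 h (by omega) (by omega) (by omega) (by omega) (by omega) (by omega) (by omega)
  have hn1 : ({0, 2, 3} : Finset ℕ) ∉ pairStar d := notMem_pairStar_of_one_notMem (by decide)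
  have hn2 : ({0, 2, 4} : Finset ℕ) ∉ pairStar d := notMem_pairStar_of_one_notMem (by decide)
  have hn3 : ({0, 3, 4} : Finset ℕ) ∉ pairStar d := notMem_pairStar_of_one_notMem (by decide)
  have hn4 : ({1, 2, 3} : Finset ℕ) ∉ pairStar d := notMem_pairStar_of_zero_notMem (by decide)
  have d1 : ({0, 2, 4} : Finset ℕ) ≠ {0, 2, 3} := by decide
  have d2 : ({0, 3, 4} : Finset ℕ) ≠ {0, 2, 3} := by decide
  have d3 : ({0, 3, 4} : Finset ℕ) ≠ {0, 2, 4} := by decide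
  have d4 : ({1, 2, 3} : Finset ℕ) ≠ {0, 2, 3} := by decide
  have d5 : ({0, 2, 4} : Finset ℕ) ≠ {1, 2, 3} := by decide
  have d6 : ({0, 3, 4} : Finset ℕ) ≠ {1, 2, 3} := by decide
  have hstarcard := card_pairStar d
  have heq : ∀ V : Finset (Finset ℕ), V ⊆ U → (∀ e ∈ U, e ∈ V) → U = V := fun V h1 h2 =>
    Subset.antisymm h2 h1
  by_cases m1 : ({0, 2, 3} : Finset ℕ) ∈ U
  · have hd2 := hcl1 m1
    by_cases m2 : ({0, 2, 4} : Finset ℕ) ∈ U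
    · have hd3 := (hcl2 m2).1
      by_cases m4 : ({1, 2, 3} : Finset ℕ) ∈ U
      · have hV : insert {0, 2, 4} (insert {1, 2, 3} (insert {0, 2, 3} (pairStar d))) ⊆ U := by
          simp only [insert_subset_iff]
          exact ⟨m2, m4, m1, hsub⟩
        have hc : (insert {0, 2, 4} (insert {1, 2, 3} (insert {0, 2, 3} (pairStar d)))).card
            = d + 3 := by
          rw [card_insert_of_notMem (by simp [hn2, d1, d5]),
            card_insert_of_notMem (by simp [hn4, d4]), card_insert_of_notMem hn1, hstarcard]
        have := card_le_card hV
        refine Or.inr (Or.inr (Or.inr (Or.inr (Or.inl ⟨by omega, ?_⟩))))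
        exact (eq_of_subset_of_card_le hV (by omega)).symm
      · by_cases m3 : ({0, 3, 4} : Finset ℕ) ∈ U
        · have hV : insert {0, 3, 4} (insert {0, 2, 4} (insert {0, 2, 3} (pairStar d))) ⊆ U := by
            simp only [insert_subset_iff]
            exact ⟨m3, m2, m1, hsub⟩
          have hc : (insert {0, 3, 4} (insert {0, 2, 4} (insert {0, 2, 3} (pairStar d)))).card
              = d + 3 := by
            rw [card_insert_of_notMem (by simp [hn3, d2, d3]),
              card_insert_of_notMem (by simp [hn2, d1]), card_insert_of_notMem hn1, hstarcard]
          have := card_le_card hV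
          refine Or.inr (Or.inr (Or.inr (Or.inr (Or.inr ⟨by omega, ?_⟩))))
          exact (eq_of_subset_of_card_le hV (by omega)).symm
        · refine Or.inr (Or.inr (Or.inl ⟨hd3, heq _ ?_ fun e he => ?_⟩))
          · simp only [insert_subset_iff]
            exact ⟨m2, m1, hsub⟩
          · rcases hform e he with h | rfl | rfl | rfl | rfl
            · simp [h]
            all_goals first | exact absurd he (by assumption) | simp
    · have m3 : ({0, 3, 4} : Finset ℕ) ∉ U := fun h => m2 (hcl3 h)
      by_cases m4 : ({1, 2, 3} : Finset ℕ) ∈ U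
      · refine Or.inr (Or.inr (Or.inr (Or.inl ⟨hd2, heq _ ?_ fun e he => ?_⟩)))
        · simp only [insert_subset_iff]
          exact ⟨m4, m1, hsub⟩
        · rcases hform e he with h | rfl | rfl | rfl | rfl
          · simp [h]
          all_goals first | exact absurd he (by assumption) | simp
      · refine Or.inr (Or.inl ⟨hd2, heq _ ?_ fun e he => ?_⟩)
        · simp only [insert_subset_iff]
          exact ⟨m1, hsub⟩
        · rcases hform e he with h | rfl | rfl | rfl | rfl
          · simp [h]
          all_goals first | exact absurd he (by assumption) | simp
  · have m2 : ({0, 2, 4} : Finset ℕ) ∉ U := fun h => m1 (hcl2 h).2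
    have m3 : ({0, 3, 4} : Finset ℕ) ∉ U := fun h => m2 (hcl3 h)
    have m4 : ({1, 2, 3} : Finset ℕ) ∉ U := fun h => m1 (hcl4 h)
    refine Or.inl (heq _ hsub fun e he => ?_)
    rcases hform e he with h | rfl | rfl | rfl | rfl
    · exact h
    all_goals exact absurd he (by assumption)

/-! ### Exchanging one missing triple while moving weight -/

theorem sum_comp_shiftWeight {α : Type*} [DecidableEq α] {V : Finset α} (f : ℝ → ℝ) (x : α → ℝ)
    {u v : α} (h : u ≠ v) (hu : u ∈ V) (hv : v ∈ V) (s : ℝ) :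
    ∑ i ∈ V, f (shiftWeight x u v s i)
      = ∑ i ∈ V, f (x i) + (f (x u + s) - f (x u)) + (f (x v - s) - f (x v)) := by
  have key : ∀ i, f (shiftWeight x u v s i) = f (x i)
      + (if i = u then f (x u + s) - f (x u) else 0)
      + (if i = v then f (x v - s) - f (x v) else 0) := by
    intro i
    rcases eq_or_ne i u with rfl | hiu
    · simp [shiftWeight_left, h]
    · rcases eq_or_ne i v with rfl | hiv
      · simp [shiftWeight_right x h, hiu]
      · simp [shiftWeight_of_ne x hiu hiv, hiu, hiv]
  simp [key, sum_add_distrib, hu, hv]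

/-- The expression bounds from below the gain in `IsExtremal.false_of_swap` when `ε` moves from `l`,
`j` to `a`, `b`. With $\sigma=l+a+b+j$ and $\tau=l+j-a-b$, the sign of $\tau$ decides the choice of
`ε`. -/
theorem exists_swap_gain {s l a b j : ℝ} (hs : 0 < s) (hsl : s ≤ l) (hla : l ≤ a) (hab : a ≤ b)
    (hbj : b ≤ j) (hsum : l + a + b + j ≤ 1)
    (hQ : (l - l ^ 2) + (j - j ^ 2) - (a - a ^ 2) - (b - b ^ 2) ≤ 2 * s * l)
    (hw : j + b - a - l < 2 * s) :
    ∃ ε, 0 < ε ∧ ε ≤ l ∧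
      0 < s * (a * b - l * j + ε * (l + a + b + j)) - ε ^ 2 * (2 - (l + a + b + j)) := by
  rcases le_or_gt (l + j - a - b) 0 with hτ | hτ
  · have hs1 : s < 1 := by linarith
    have hl : 0 < l := by linarith
    -- Now $ab\ge lj$, so the exchange itself loses nothing; $\varepsilon=sl$ leaves at least
    -- $s^2l(\sigma-l(2-\sigma))>0$, as $\sigma\ge4l$.
    refine ⟨s * l, mul_pos hs hl, by nlinarith, ?_⟩
    have h1 : 0 ≤ a * b - l * j := by nlinarith
    have h2 : l * (2 - (l + a + b + j)) < l + a + b + j := by nlinarith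
    have h3 : 0 < s * (s * l) * (l + a + b + j - l * (2 - (l + a + b + j))) :=
      mul_pos (mul_pos hs (mul_pos hs hl)) (by linarith)
    nlinarith [mul_nonneg hs.le h1]
  · set τ := l + j - a - b with hτd
    -- This `ε` makes the pair sums $l+j$ and $a+b$ equal. The gain becomes
    -- $s(a-l)(b-l)+\frac\tau4\bigl(2s(\sigma-2l)-\tau(2-\sigma)\bigr)$, whose last bracket is
    -- positive by `hQ` and `hw`.
    refine ⟨τ / 2, by linarith, by linarith, ?_⟩
    have h1 : τ * (1 - j - b) ≤ 2 * s * l + (a - l) * (j + b - l - a) := by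
      refine le_trans (le_of_eq ?_) (add_le_add_left hQ _)
      rw [hτd]
      ring
    have h2 : (a - l) * (j + b - a - l) ≤ (a - l) * (2 * s) :=
      mul_le_mul_of_nonneg_left hw.le (by linarith)
    have h3 : τ * (j + b - a - l) < 2 * s * (j + b - a - l) :=
      mul_lt_mul_of_pos_right (by linarith) (by linarith)
    have h4 : τ * (2 - (l + a + b + j)) < 2 * (s * (l + a + b + j - 2 * l)) := by nlinarith
    have h5 : 0 ≤ s * ((a - l) * (b - l)) :=
      mul_nonneg hs.le (mul_nonneg (by linarith) (by linarith))
    have h6 := mul_lt_mul_of_pos_left h4 hτ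
    have h7 : s * (a * b - l * j) = s * ((a - l) * (b - l)) - s * l * τ := by
      rw [hτd]
      ring
    nlinarith

theorem edgePoly_insert_triple {H : Finset (Finset ℕ)} {a b c : ℕ} (h : {a, b, c} ∉ H)
    (hab : a ≠ b) (hac : a ≠ c) (hbc : b ≠ c) (x : ℕ → ℝ) :
    edgePoly (insert {a, b, c} H) x = x a * x b * x c + edgePoly H x := by
  rw [edgePoly_insert h, prod_insert (by simp [hab, hac]), prod_insert (by simp [hbc]),
    prod_singleton, mul_assoc]

theorem partialPoly_insert_triple {H : Finset (Finset ℕ)} {a b c : ℕ} (h : {a, b, c} ∉ H)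
    (hab : a ≠ b) (hac : a ≠ c) (hbc : b ≠ c) (w : ℕ) (x : ℕ → ℝ) :
    partialPoly (insert {a, b, c} H) w x
      = (if w = a then x b * x c else if w = b then x a * x c else if w = c then x a * x b else 0)
        + partialPoly H w x := by
  rw [partialPoly_insert h]
  congr 1
  by_cases ha : w = a
  · subst ha
    rw [if_pos (by simp), if_pos rfl, erase_insert (by simp [hab, hac]), prod_pair hbc]
  by_cases hb : w = b
  · subst hb
    rw [if_pos (by simp), if_neg ha, if_pos rfl, insert_comm,
      erase_insert (by simp [ha, hbc]), prod_pair hac]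
  by_cases hc : w = c
  · subst hc
    rw [if_pos (by simp), if_neg ha, if_neg hb, if_pos rfl, pair_comm, insert_comm,
      erase_insert (by simp [ha, hb]), prod_pair hab]
  · rw [if_neg (by simp [ha, hb, hc]), if_neg ha, if_neg hb, if_neg hc]

namespace IsExtremal

variable {m k : ℕ} {L : ℝ} {H : Finset (Finset ℕ)} {x : ℕ → ℝ}

theorem isShifted_compl (h : IsExtremal m k L H x) : IsShifted (powersetCard 3 (range k) \ H) := by
  intro e he i hi j hj hji
  obtain ⟨heT, heH⟩ := mem_sdiff.1 he
  obtain ⟨heV, he3⟩ := mem_powersetCard.1 heT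
  have hik := mem_range.1 (heV hi)
  have hj' : j ∉ e.erase i := fun h => hj (mem_of_mem_erase h)
  refine mem_sdiff.2 ⟨mem_powersetCard.2 ⟨insert_subset (mem_range.2 (hji.trans hik))
    ((erase_subset _ _).trans heV), ?_⟩, fun hmem => heH ?_⟩
  · rw [card_insert_of_notMem hj', card_erase_of_mem hi, he3]
  · have := h.up _ hmem j (mem_insert_self _ _) i hik (by simp [hji.ne']) hji
    rwa [erase_insert hj', insert_erase hi] at this

/-- Comparison of an extremal weighting with another weighting and another set of missing edges. -/
theorem compare (h : IsExtremal m k L H x) {U : Finset (Finset ℕ)}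
    (hU : U ⊆ powersetCard 3 (range k)) (hc : (powersetCard 3 (range k) \ H).card ≤ U.card)
    {y : ℕ → ℝ} (hy : ∀ i, 0 ≤ y i) (hs : ∑ i ∈ range k, y i = 1) :
    (∑ i ∈ range k, x i ^ 2 - ∑ i ∈ range k, y i ^ 2) / 2
      + (∑ i ∈ range k, y i ^ 3 - ∑ i ∈ range k, x i ^ 3) / 3
      + edgePoly (powersetCard 3 (range k) \ H) x - edgePoly U y ≤ 0 := by
  have h1 := h.max (powersetCard 3 (range k) \ U) sdiff_subset (by
    have h2 := card_sdiff_add_card_eq_card hU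
    have h3 := card_sdiff_add_card_eq_card h.subset
    have := h.card_le
    omega) y hy hs
  have h2 := edgePoly_sdiff_add hU y
  have h3 := edgePoly_sdiff_add h.subset x
  have h4 := six_mul_edgePoly_powersetCard_three (range k) x
  have h5 := six_mul_edgePoly_powersetCard_three (range k) y
  rw [h.sum_eq] at h4
  rw [hs] at h5
  linarith

/-- No exchange of a missing edge `{s, a, b}` against `{s, l, j}`, accompanied by the transfer of
weight from `l`, `j` to `a`, `b`, can pay off. -/
theorem false_of_swap (h : IsExtremal m k L H x) {U U' : Finset (Finset ℕ)}
    (hU : powersetCard 3 (range k) \ H = U)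
    (hU' : U' ⊆ powersetCard 3 (range k)) (hc : U.card ≤ U'.card)
    {l a b j : ℕ} (hl : l < k) (ha : a < k) (hb : b < k) (hj : j < k) (hla : l < a) (hab : a < b)
    (hbj : b < j) {s : ℝ} (hs : 0 < s) (hsl : s ≤ x l) (hsum : x l + x a + x b + x j ≤ 1)
    (hQ : partialPoly U a x + partialPoly U b x - partialPoly U l x - partialPoly U j x
      ≤ 2 * s * x l)
    (hw : x j + x b - x a - x l < 2 * s)
    (hgain : ∀ ε, 0 < ε → ∀ y : ℕ → ℝ, y l = x l - ε → y a = x a + ε → y b = x b + ε →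
      y j = x j - ε → (∀ i, i ≠ l → i ≠ a → i ≠ b → i ≠ j → y i = x i) →
      s * (x a * x b - x l * x j + ε * (x l + x a + x b + x j))
      ≤ edgePoly U x - edgePoly U' y
        + ε * (partialPoly U a x + partialPoly U b x - partialPoly U l x - partialPoly U j x)) :
    False := by
  have e1 := h.sub_sq_add_partialPoly_compl hl ha
  have e2 := h.sub_sq_add_partialPoly_compl hl hb
  have e3 := h.sub_sq_add_partialPoly_compl hl hj
  rw [hU] at e1 e2 e3
  obtain ⟨ε, hε, hεl, hpos⟩ := exists_swap_gain hs hsl (h.mono l a hla.le ha) (h.mono a b hab.le hb)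
    (h.mono b j hbj.le hj) hsum (by linarith) hw
  have hxlj := h.mono l j (by omega) hj
  set z := shiftWeight x a l ε with hz
  have hzb : z b = x b := shiftWeight_of_ne x (by omega) (by omega) ε
  have hzj : z j = x j := shiftWeight_of_ne x (by omega) (by omega) ε
  have hz0 : ∀ i, 0 ≤ z i := h.shiftWeight_nonneg (by omega) hε.le hεl
  have hzs : ∀ f : ℝ → ℝ, ∑ i ∈ range k, f (z i) = ∑ i ∈ range k, f (x i)
      + (f (x a + ε) - f (x a)) + (f (x l - ε) - f (x l)) := fun f =>
    sum_comp_shiftWeight f x (by omega) (mem_range.2 ha) (mem_range.2 hl) ε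
  set y := shiftWeight z b j ε with hy
  have hga := hgain ε hε y (by rw [hy, shiftWeight_of_ne _ (by omega) (by omega), hz,
      shiftWeight_right _ (by omega)])
    (by rw [hy, shiftWeight_of_ne _ (by omega) (by omega), hz, shiftWeight_left])
    (by rw [hy, shiftWeight_left, hzb]) (by rw [hy, shiftWeight_right _ (by omega), hzj])
    (fun i h1 h2 h3 h4 => by rw [hy, shiftWeight_of_ne _ h3 h4, hz, shiftWeight_of_ne _ h2 h1])
  rw [show partialPoly U a x + partialPoly U b x - partialPoly U l x - partialPoly U j x
    = x l - x l ^ 2 + (x j - x j ^ 2) - (x a - x a ^ 2) - (x b - x b ^ 2) by linarith] at hga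
  have hys : ∀ f : ℝ → ℝ, ∑ i ∈ range k, f (y i) = ∑ i ∈ range k, f (z i)
      + (f (x b + ε) - f (x b)) + (f (x j - ε) - f (x j)) := fun f => by
    rw [← hzb, ← hzj]
    exact sum_comp_shiftWeight f z (by omega) (mem_range.2 hb) (mem_range.2 hj) ε
  have hy0 : ∀ i, 0 ≤ y i := by
    intro i
    rw [hy]
    unfold shiftWeight
    split_ifs with h1 h2
    · linarith [hz0 i]
    · rw [h2, hzj]
      linarith
    · exact hz0 i
  have hysum : ∑ i ∈ range k, y i = 1 := by
    have h1 := hys id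
    have h2 := hzs id
    simp only [id] at h1 h2
    rw [h1, h2, h.sum_eq]
    ring
  have hcmp := h.compare hU' (by rwa [hU]) hy0 hysum
  have p2 := hys (fun r => r ^ 2)
  have p3 := hys (fun r => r ^ 3)
  have q2 := hzs (fun r => r ^ 2)
  have q3 := hzs (fun r => r ^ 3)
  rw [p2, p3, q2, q3, hU] at hcmp
  -- The cubes of `ε` cancel in the sum of cubes. The squares and cubes contribute `ε` times the
  -- bracket rewritten in `hga`, minus $\varepsilon^2(2-\sigma)$ with $\sigma=x_l+x_a+x_b+x_j$, so
  -- `hga` and `hpos` contradict `hcmp`.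
  linarith

end IsExtremal

/-! ### Missing systems excluded by an exchange -/

theorem sum_range_add_two_split (n : ℕ) (f : ℕ → ℝ) :
    ∑ i ∈ range (n + 2), f (i + 2) = f 2 + f 3 + ∑ i ∈ range n, f (i + 4) := by
  rw [sum_range_succ', sum_range_succ']
  simp only [zero_add, add_assoc, Nat.reduceAdd]
  ring

theorem sum_range_add_three_split (n : ℕ) (f : ℕ → ℝ) :
    ∑ i ∈ range (n + 3), f (i + 2) = f 2 + f 3 + f 4 + ∑ i ∈ range n, f (i + 5) := by
  rw [sum_range_succ', sum_range_succ', sum_range_succ']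
  simp only [zero_add, add_assoc, Nat.reduceAdd]
  ring

/-- For two vertices with the same role among the missing triples, the difference of the optimality
conditions factors in this way, so they have equal weights. -/
theorem eq_of_sub_mul_eq_zero {a b w : ℝ} (hw : 0 < w) (h : (a - b) * w = 0) : a = b := by
  rcases mul_eq_zero.1 h with h | h
  · linarith
  · linarith

namespace IsExtremal

variable {m k : ℕ} {L : ℝ} {H : Finset (Finset ℕ)} {x : ℕ → ℝ}

theorem sum_range_le_one (h : IsExtremal m k L H x) {n : ℕ} (hn : n ≤ k) :
    ∑ i ∈ range n, x i ≤ 1 := by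
  rw [← h.sum_eq]
  exact sum_le_sum_of_subset_of_nonneg (range_subset_range.2 hn) fun i _ _ => h.nonneg i

theorem sum_pairStar_le (h : IsExtremal m k L H x) {d : ℕ} (hd : d + 3 ≤ k) :
    x 0 + x 1 + ∑ i ∈ range d, x (i + 2) + x (d + 2) ≤ 1 := by
  have := h.sum_range_le_one hd
  rw [sum_range_succ, sum_range_succ', sum_range_succ'] at this
  simp only [zero_add, add_assoc, Nat.reduceAdd] at this ⊢
  linarith

theorem sum_pairStar_le' (h : IsExtremal m k L H x) {d : ℕ} (hd : d + 4 ≤ k) :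
    x 0 + x 1 + ∑ i ∈ range d, x (i + 2) + x (d + 2) + x (d + 3) ≤ 1 := by
  have := h.sum_range_le_one hd
  rw [sum_range_succ, sum_range_succ, sum_range_succ', sum_range_succ'] at this
  simp only [zero_add, add_assoc, Nat.reduceAdd] at this ⊢
  linarith

/-- The triple $\{0,2,3\}$ is exchanged for the next star triple $\{0,1,n+4\}$; the pivot is vertex
0. -/
theorem false_of_missing_023 (h : IsExtremal m k L H x) {n : ℕ} (hn : n + 5 ≤ k)
    (hU : powersetCard 3 (range k) \ H = insert {0, 2, 3} (pairStar (n + 2))) : False := by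
  have hn1 : ({0, 2, 3} : Finset ℕ) ∉ pairStar (n + 2) :=
    notMem_pairStar_of_one_notMem (by decide)
  have hX := fun w => partialPoly_insert_triple hn1 (by decide) (by decide) (by decide) w x
  have X1 := hX 1
  have X2 := hX 2
  have X3 := hX 3
  have Xj := hX (n + 4)
  rw [partialPoly_pairStar_one, sum_range_add_two_split] at X1
  rw [partialPoly_pairStar_of_lt (by omega) (by omega)] at X2 X3
  rw [partialPoly_pairStar_of_ge (by omega)] at Xj
  simp at X1 X2 X3
  rw [if_neg (by omega), if_neg (by omega), if_neg (by omega)] at Xj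
  have K2 := h.sub_sq_add_partialPoly_compl (u := 2) (v := 3) (by omega) (by omega)
  have K1 := h.sub_sq_add_partialPoly_compl (u := 1) (v := n + 4) (by omega) (by omega)
  rw [hU] at K1 K2
  rw [X2, X3] at K2
  rw [X1, Xj] at K1
  have hsum := h.sum_pairStar_le (d := n + 2) (by omega)
  rw [sum_range_add_two_split, show n + 2 + 2 = n + 4 by omega] at hsum
  have p0 := h.pos (by omega : 0 < k)
  have p1 := h.pos (by omega : 1 < k)
  have p2 := h.pos (by omega : 2 < k)
  have p3 := h.pos (by omega : 3 < k)
  have o := h.mono 0 1 (by omega) (by omega)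
  have hR : 0 ≤ ∑ i ∈ range n, x (i + 4) := sum_nonneg fun i _ => h.nonneg _
  have h23 : x 3 = x 2 := eq_of_sub_mul_eq_zero (w := 1 - x 2 - x 3 - x 0)
    (by linarith [h.nonneg (n + 4)]) (by linear_combination -K2)
  refine h.false_of_swap hU (U' := pairStar (n + 3)) (pairStar_subset (by omega)) ?_
    (l := 1) (a := 2) (b := 3) (j := n + 4) (by omega) (by omega) (by omega) (by omega) (by omega)
    (by omega) (by omega) p0 o (by linarith) ?_ ?_ ?_
  · rw [card_insert_of_notMem hn1, card_pairStar, card_pairStar]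
  · rw [X1, X2, X3, Xj, h23]
    nlinarith [mul_nonneg p0.le hR]
  -- With $j=n+4$, `K1` factors as $(x_j-x_1)(1-x_1-x_j)=x_0(x_2+x_3+R)$, $R$ being the rest of the
  -- star. The last bracket is below $1-x_1-x_j$ because $x_0>0$ is left over.
  · have : x (n + 4) - x 1 < x 0 := by
      refine lt_of_mul_lt_mul_right (a := 1 - x 1 - x (n + 4)) ?_ (by linarith)
      have := mul_lt_mul_of_pos_left (a := x 0)
        (show x 2 + x 3 + ∑ i ∈ range n, x (i + 4) < 1 - x 1 - x (n + 4) by linarith) p0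
      linarith
    linarith
  · intro ε hε y y1 y2 y3 yj hy
    have y0 := hy 0 (by omega) (by omega) (by omega) (by omega)
    have yR : ∑ i ∈ range n, y (i + 4) = ∑ i ∈ range n, x (i + 4) := sum_congr rfl fun i hi =>
      hy _ (by omega) (by omega) (by omega) (by have := mem_range.1 hi; omega)
    rw [edgePoly_insert_triple hn1 (by decide) (by decide) (by decide), edgePoly_pairStar,
      sum_range_add_two_split, edgePoly_pairStar, sum_range_succ, sum_range_add_two_split,
      show n + 2 + 2 = n + 4 by omega, X1, X2, X3, Xj, y0, y1, y2, y3, yj, yR]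
    have := mul_nonneg p0.le (sq_nonneg ε)
    linarith

/-- The triple $\{0,2,4\}$ is exchanged for $\{0,1,n+5\}$, with pivot 0. -/
theorem false_of_missing_024 (h : IsExtremal m k L H x) {n : ℕ} (hn : n + 7 ≤ k)
    (hU : powersetCard 3 (range k) \ H = insert {0, 2, 4} (insert {0, 2, 3} (pairStar (n + 3)))) :
    False := by
  have hn1 : ({0, 2, 3} : Finset ℕ) ∉ pairStar (n + 3) :=
    notMem_pairStar_of_one_notMem (by decide)
  have hn1' : ({0, 2, 3} : Finset ℕ) ∉ pairStar (n + 4) :=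
    notMem_pairStar_of_one_notMem (by decide)
  have hn2 : ({0, 2, 4} : Finset ℕ) ∉ insert {0, 2, 3} (pairStar (n + 3)) := by
    rw [mem_insert, not_or]
    exact ⟨by decide, notMem_pairStar_of_one_notMem (by decide)⟩
  have hX := fun w => partialPoly_insert_triple hn2 (by decide) (by decide) (by decide) w x
  simp only [partialPoly_insert_triple hn1 (a := 0) (b := 2) (c := 3) (by decide) (by decide)
    (by decide)] at hX
  have X1 := hX 1
  have X2 := hX 2
  have X3 := hX 3
  have X4 := hX 4
  have Xj := hX (n + 5)
  rw [partialPoly_pairStar_one, sum_range_add_three_split] at X1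
  rw [partialPoly_pairStar_of_lt (by omega) (by omega)] at X2 X3 X4
  rw [partialPoly_pairStar_of_ge (by omega)] at Xj
  simp at X1 X2 X3 X4 Xj
  have K3 := h.sub_sq_add_partialPoly_compl (u := 3) (v := 4) (by omega) (by omega)
  have K1 := h.sub_sq_add_partialPoly_compl (u := 1) (v := n + 5) (by omega) (by omega)
  have K2 := h.sub_sq_add_partialPoly_compl (u := 2) (v := n + 5) (by omega) (by omega)
  rw [hU] at K1 K2 K3
  rw [X3, X4] at K3
  rw [X1, Xj] at K1
  rw [X2, Xj] at K2
  have hsum := h.sum_pairStar_le (d := n + 3) (by omega)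
  rw [sum_range_add_three_split, show n + 3 + 2 = n + 5 by omega] at hsum
  have p0 := h.pos (by omega : 0 < k)
  have p1 := h.pos (by omega : 1 < k)
  have p2 := h.pos (by omega : 2 < k)
  have p3 := h.pos (by omega : 3 < k)
  have p4 := h.pos (by omega : 4 < k)
  have pj := h.pos (by omega : n + 5 < k)
  have o := h.mono 0 1 (by omega) (by omega)
  have o4 := h.mono 4 (n + 5) (by omega) (by omega)
  have hR : 0 ≤ ∑ i ∈ range n, x (i + 5) := sum_nonneg fun i _ => h.nonneg _
  have h34 : x 3 = x 4 := eq_of_sub_mul_eq_zero (w := 1 - x 3 - x 4) (by linarith)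
    (by linear_combination K3)
  refine h.false_of_swap hU (U' := insert {0, 2, 3} (pairStar (n + 4))) ?_ ?_
    (l := 1) (a := 2) (b := 4) (j := n + 5) (by omega) (by omega) (by omega) (by omega) (by omega)
    (by omega) (by omega) p0 o (by linarith) ?_ ?_ ?_
  · refine insert_subset ?_ (pairStar_subset (by omega))
    have : ({0, 2, 3} : Finset ℕ) ∈ powersetCard 3 (range k) \ H := by rw [hU]; simp
    exact (mem_sdiff.1 this).1
  · rw [card_insert_of_notMem hn2, card_insert_of_notMem hn1, card_insert_of_notMem hn1',
      card_pairStar, card_pairStar]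
  · rw [X1, X2, X4, Xj]
    nlinarith [mul_nonneg p0.le hR]
  · have h1 : x (n + 5) - x 1 < x 0 := by
      refine lt_of_mul_lt_mul_right (a := 1 - x 1 - x (n + 5)) ?_ (by linarith)
      have := mul_lt_mul_of_pos_left (a := x 0)
        (show x 2 + x 3 + x 4 + ∑ i ∈ range n, x (i + 5) < 1 - x 1 - x (n + 5) by linarith) p0
      linarith
    have h2 : x (n + 5) - x 2 < x 0 := by
      refine lt_of_mul_lt_mul_right (a := 1 - x 2 - x (n + 5)) ?_ (by linarith)
      have := mul_lt_mul_of_pos_left (a := x 0)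
        (show x 1 + x 3 + x 4 < 1 - x 2 - x (n + 5) by linarith) p0
      linarith
    linarith
  · intro ε hε y y1 y2 y4 yj hy
    have y0 := hy 0 (by omega) (by omega) (by omega) (by omega)
    have y3 := hy 3 (by omega) (by omega) (by omega) (by omega)
    have yR : ∑ i ∈ range n, y (i + 5) = ∑ i ∈ range n, x (i + 5) := sum_congr rfl fun i hi =>
      hy _ (by omega) (by omega) (by omega) (by have := mem_range.1 hi; omega)
    rw [edgePoly_insert_triple hn2 (by decide) (by decide) (by decide),
      edgePoly_insert_triple hn1 (by decide) (by decide) (by decide), edgePoly_pairStar,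
      sum_range_add_three_split, edgePoly_insert_triple hn1' (by decide) (by decide) (by decide),
      edgePoly_pairStar, sum_range_succ, sum_range_add_three_split,
      show n + 3 + 2 = n + 5 by omega, X1, X2, X4, Xj, y0, y1, y2, y3, y4, yj, yR]
    have := mul_nonneg p0.le (sq_nonneg ε)
    linarith

/-- The triple $\{1,2,3\}$ is exchanged for $\{0,1,n+5\}$. The pivot is vertex 1, and 0 and 1 have
equal weight, so $s=x_0$ still serves. -/
theorem false_of_missing_123 (h : IsExtremal m k L H x) {n : ℕ} (hn : n + 7 ≤ k)
    (hU : powersetCard 3 (range k) \ H = insert {1, 2, 3} (insert {0, 2, 3} (pairStar (n + 3)))) :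
    False := by
  have hn1 : ({0, 2, 3} : Finset ℕ) ∉ pairStar (n + 3) :=
    notMem_pairStar_of_one_notMem (by decide)
  have hn1' : ({0, 2, 3} : Finset ℕ) ∉ pairStar (n + 4) :=
    notMem_pairStar_of_one_notMem (by decide)
  have hn2 : ({1, 2, 3} : Finset ℕ) ∉ insert {0, 2, 3} (pairStar (n + 3)) := by
    rw [mem_insert, not_or]
    exact ⟨by decide, notMem_pairStar_of_zero_notMem (by decide)⟩
  have hX := fun w => partialPoly_insert_triple hn2 (by decide) (by decide) (by decide) w x
  simp only [partialPoly_insert_triple hn1 (a := 0) (b := 2) (c := 3) (by decide) (by decide)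
    (by decide)] at hX
  have X0 := hX 0
  have X1 := hX 1
  have X2 := hX 2
  have X3 := hX 3
  have Xj := hX (n + 5)
  rw [partialPoly_pairStar_zero, sum_range_add_three_split] at X0
  rw [partialPoly_pairStar_one, sum_range_add_three_split] at X1
  rw [partialPoly_pairStar_of_lt (by omega) (by omega)] at X2 X3
  rw [partialPoly_pairStar_of_ge (by omega)] at Xj
  simp at X0 X1 X2 X3 Xj
  have K0 := h.sub_sq_add_partialPoly_compl (u := 0) (v := n + 5) (by omega) (by omega)
  have K1 := h.sub_sq_add_partialPoly_compl (u := 0) (v := 1) (by omega) (by omega)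
  have K2 := h.sub_sq_add_partialPoly_compl (u := 0) (v := 2) (by omega) (by omega)
  have K3 := h.sub_sq_add_partialPoly_compl (u := 2) (v := 3) (by omega) (by omega)
  rw [hU] at K0 K1 K2 K3
  rw [X0, Xj] at K0
  rw [X0, X1] at K1
  rw [X0, X2] at K2
  rw [X2, X3] at K3
  have hsum := h.sum_pairStar_le' (d := n + 3) (by omega)
  rw [sum_range_add_three_split, show n + 3 + 2 = n + 5 by omega,
    show n + 3 + 3 = n + 6 by omega] at hsum
  have p0 := h.pos (by omega : 0 < k)
  have p1 := h.pos (by omega : 1 < k)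
  have p2 := h.pos (by omega : 2 < k)
  have p3 := h.pos (by omega : 3 < k)
  have p4 := h.pos (by omega : 4 < k)
  have pj := h.pos (by omega : n + 5 < k)
  have pj' := h.pos (by omega : n + 6 < k)
  have o02 := h.mono 0 2 (by omega) (by omega)
  have o24 := h.mono 2 4 (by omega) (by omega)
  have o2j := h.mono 2 (n + 6) (by omega) (by omega)
  have hR : 0 ≤ ∑ i ∈ range n, x (i + 5) := sum_nonneg fun i _ => h.nonneg _
  have h01 : x 1 = x 0 := eq_of_sub_mul_eq_zero
    (w := 1 - x 0 - x 1 - (x 2 + x 3 + x 4 + ∑ i ∈ range n, x (i + 5)))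
    (by linarith) (by linear_combination -K1)
  have h23 : x 3 = x 2 := eq_of_sub_mul_eq_zero (w := 1 - x 2 - x 3 - x 0 - x 1)
    (by linarith) (by linear_combination -K3)
  rw [h01, h23] at K2 K0 hsum
  refine h.false_of_swap hU (U' := insert {0, 2, 3} (pairStar (n + 4))) ?_ ?_
    (l := 0) (a := 2) (b := 3) (j := n + 5) (by omega) (by omega) (by omega) (by omega) (by omega)
    (by omega) (by omega) p0 le_rfl (by linarith) ?_ ?_ ?_
  · refine insert_subset ?_ (pairStar_subset (by omega))
    have : ({0, 2, 3} : Finset ℕ) ∈ powersetCard 3 (range k) \ H := by rw [hU]; simp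
    exact (mem_sdiff.1 this).1
  · rw [card_insert_of_notMem hn2, card_insert_of_notMem hn1, card_insert_of_notMem hn1',
      card_pairStar, card_pairStar]
  · rw [X0, X2, X3, Xj, h01, h23]
    nlinarith [mul_nonneg p0.le hR, mul_le_mul_of_nonneg_left o24 p0.le,
      mul_le_mul_of_nonneg_left o02 p2.le]
  · have h1 : x 2 - x 0 ≤ x 0 := by
      refine le_of_mul_le_mul_right (a := 1 - 2 * x 0 - 2 * x 2) ?_ (by linarith)
      have := mul_le_mul_of_nonneg_left (a := x 0)
        (show x 4 + ∑ i ∈ range n, x (i + 5) ≤ 1 - 2 * x 0 - 2 * x 2 by linarith) p0.le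
      linarith
    have h2 : x (n + 5) - x 0 < 2 * x 0 := by
      refine lt_of_mul_lt_mul_right (a := 1 - x 0 - x (n + 5)) ?_ (by linarith)
      have := mul_le_mul_of_nonneg_left (a := 2 * x 0)
        (show x 0 + (x 2 + x 2 + x 4 + ∑ i ∈ range n, x (i + 5)) + x 2 ≤ 1 - x 0 - x (n + 5)
          by linarith) (by linarith)
      nlinarith [mul_nonneg p0.le hR, mul_le_mul_of_nonneg_left o24 p0.le, mul_pos p0 p2,
        mul_pos p0 p0, mul_le_mul_of_nonneg_left h1 p2.le]
    linarith
  · intro ε hε y y0 y2 y3 yj hy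
    have y1 := hy 1 (by omega) (by omega) (by omega) (by omega)
    have y4 := hy 4 (by omega) (by omega) (by omega) (by omega)
    have yR : ∑ i ∈ range n, y (i + 5) = ∑ i ∈ range n, x (i + 5) := sum_congr rfl fun i hi =>
      hy _ (by omega) (by omega) (by omega) (by have := mem_range.1 hi; omega)
    rw [edgePoly_insert_triple hn2 (by decide) (by decide) (by decide),
      edgePoly_insert_triple hn1 (by decide) (by decide) (by decide), edgePoly_pairStar,
      sum_range_add_three_split, edgePoly_insert_triple hn1' (by decide) (by decide) (by decide),
      edgePoly_pairStar, sum_range_succ, sum_range_add_three_split,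
      show n + 3 + 2 = n + 5 by omega, X0, X2, X3, Xj, y0, y1, y2, y3, y4, yj, yR, h01, h23]
    have h1 := mul_nonneg p2.le (sq_nonneg ε)
    have h2 := pow_pos hε 3
    linarith

/-- The triple $\{0,2,4\}$ is exchanged for $\{0,1,5\}$. Vertices 1 and 2 are twins, and
$2x_1\le3x_0$ absorbs the extra term coming from $\{1,2,3\}$. -/
theorem false_of_missing_024_123 (h : IsExtremal m k L H x) (hk : 8 ≤ k)
    (hU : powersetCard 3 (range k) \ H
      = insert {0, 2, 4} (insert {1, 2, 3} (insert {0, 2, 3} (pairStar 3)))) : False := by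
  have hn1 : ∀ d, ({0, 2, 3} : Finset ℕ) ∉ pairStar d := fun d =>
    notMem_pairStar_of_one_notMem (by decide)
  have hn2 : ∀ d, ({1, 2, 3} : Finset ℕ) ∉ insert {0, 2, 3} (pairStar d) := fun d => by
    rw [mem_insert, not_or]
    exact ⟨by decide, notMem_pairStar_of_zero_notMem (by decide)⟩
  have hn3 : ({0, 2, 4} : Finset ℕ) ∉ insert {1, 2, 3} (insert {0, 2, 3} (pairStar 3)) := by
    rw [mem_insert, mem_insert, not_or, not_or]
    exact ⟨by decide, by decide, notMem_pairStar_of_one_notMem (by decide)⟩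
  have hX := fun w => partialPoly_insert_triple hn3 (by decide) (by decide) (by decide) w x
  simp only [partialPoly_insert_triple (hn1 3) (a := 0) (b := 2) (c := 3) (by decide) (by decide)
    (by decide), partialPoly_insert_triple (hn2 3) (a := 1) (b := 2) (c := 3) (by decide)
    (by decide) (by decide)] at hX
  have X0 := hX 0
  have X1 := hX 1
  have X2 := hX 2
  have X3 := hX 3
  have X4 := hX 4
  have X5 := hX 5
  rw [partialPoly_pairStar_zero] at X0
  rw [partialPoly_pairStar_one] at X1
  rw [partialPoly_pairStar_of_lt (by omega) (by omega)] at X2 X3 X4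
  rw [partialPoly_pairStar_of_ge (by omega)] at X5
  simp [sum_range_succ] at X0 X1 X2 X3 X4 X5
  have K0 := h.sub_sq_add_partialPoly_compl (u := 0) (v := 1) (by omega) (by omega)
  have K2 := h.sub_sq_add_partialPoly_compl (u := 1) (v := 2) (by omega) (by omega)
  have K4 := h.sub_sq_add_partialPoly_compl (u := 1) (v := 4) (by omega) (by omega)
  have K5 := h.sub_sq_add_partialPoly_compl (u := 1) (v := 5) (by omega) (by omega)
  rw [hU] at K0 K2 K4 K5
  rw [X0, X1] at K0
  rw [X1, X2] at K2
  rw [X1, X4] at K4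
  rw [X1, X5] at K5
  have hsum := h.sum_range_le_one hk
  simp only [sum_range_succ, sum_range_zero] at hsum
  have p0 := h.pos (by omega : 0 < k)
  have p1 := h.pos (by omega : 1 < k)
  have p3 := h.pos (by omega : 3 < k)
  have p4 := h.pos (by omega : 4 < k)
  have p5 := h.pos (by omega : 5 < k)
  have o01 := h.mono 0 1 (by omega) (by omega)
  have o13 := h.mono 1 3 (by omega) (by omega)
  have o34 := h.mono 3 4 (by omega) (by omega)
  have o45 := h.mono 4 5 (by omega) (by omega)
  have o56 := h.mono 5 6 (by omega) (by omega)
  have o67 := h.mono 6 7 (by omega) (by omega)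
  have h12 : x 2 = x 1 := eq_of_sub_mul_eq_zero (w := 1 - x 1 - x 2 - x 3 - x 0)
    (by linarith) (by linear_combination -K2)
  rw [h12] at K0 K4 K5 hsum
  have h10 : 2 * x 1 ≤ 3 * x 0 := by
    have h1 : x 1 - x 0 ≤ x 1 / 3 := by
      refine le_of_mul_le_mul_right (a := 1 - 2 * x 1 - x 0 - x 3 - x 4) ?_ (by linarith)
      have := mul_le_mul_of_nonneg_left (a := x 1 / 3)
        (show 3 * x 4 ≤ 1 - 2 * x 1 - x 0 - x 3 - x 4 by linarith) (by linarith)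
      linarith
    linarith
  have h13 := mul_le_mul_of_nonneg_right h10 p3.le
  refine h.false_of_swap hU (U' := insert {1, 2, 3} (insert {0, 2, 3} (pairStar 4))) ?_ ?_
    (l := 1) (a := 2) (b := 4) (j := 5) (by omega) (by omega) (by omega) (by omega) (by omega)
    (by omega) (by omega) p0 o01 (by linarith) ?_ ?_ ?_
  · have h1 : ({0, 2, 3} : Finset ℕ) ∈ powersetCard 3 (range k) \ H := by rw [hU]; simp
    have h2 : ({1, 2, 3} : Finset ℕ) ∈ powersetCard 3 (range k) \ H := by rw [hU]; simp
    exact insert_subset (mem_sdiff.1 h2).1 (insert_subset (mem_sdiff.1 h1).1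
      (pairStar_subset (by omega)))
  · rw [card_insert_of_notMem hn3, card_insert_of_notMem (hn2 3), card_insert_of_notMem (hn1 3),
      card_insert_of_notMem (hn2 4), card_insert_of_notMem (hn1 4), card_pairStar, card_pairStar]
  · rw [X1, X2, X4, X5, h12]
    linarith
  · have h1 : x 5 - x 1 < x 0 := by
      refine lt_of_mul_lt_mul_right (a := 1 - x 1 - x 5) ?_ (by linarith)
      have := mul_le_mul_of_nonneg_left (a := x 0)
        (show x 0 + x 1 + x 3 + x 4 + x 3 + x 3 ≤ 1 - x 1 - x 5 by linarith) p0.le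
      nlinarith [mul_pos p0 p0, mul_pos p0 p3]
    have h2 : x 4 - x 1 < x 0 := by
      refine lt_of_mul_lt_mul_right (a := 1 - x 1 - x 4) ?_ (by linarith)
      have := mul_le_mul_of_nonneg_left (a := x 0)
        (show x 0 + x 1 + x 3 + x 3 + x 3 + x 4 ≤ 1 - x 1 - x 4 by linarith) p0.le
      nlinarith [mul_pos p0 p0, mul_pos p0 p3, mul_pos p0 p1]
    linarith
  · intro ε hε y y1 y2 y4 y5 hy
    have y0 := hy 0 (by omega) (by omega) (by omega) (by omega)
    have y3 := hy 3 (by omega) (by omega) (by omega) (by omega)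
    rw [edgePoly_insert_triple hn3 (by decide) (by decide) (by decide),
      edgePoly_insert_triple (hn2 3) (by decide) (by decide) (by decide),
      edgePoly_insert_triple (hn1 3) (by decide) (by decide) (by decide),
      edgePoly_insert_triple (hn2 4) (by decide) (by decide) (by decide),
      edgePoly_insert_triple (hn1 4) (by decide) (by decide) (by decide),
      edgePoly_pairStar, edgePoly_pairStar]
    simp only [sum_range_succ, sum_range_zero, zero_add, Nat.reduceAdd]
    rw [X1, X2, X4, X5, y0, y1, y2, y3, y4, y5, h12]
    have h1 := mul_nonneg p0.le (sq_nonneg ε)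
    have h2 := mul_nonneg p3.le (sq_nonneg ε)
    linarith

end IsExtremal

/-! ### Missing systems excluded by an explicit reweighting -/

namespace IsExtremal

variable {m k : ℕ} {L : ℝ} {H : Finset (Finset ℕ)} {x : ℕ → ℝ}

/-- The comparison for weightings that differ from the extremal one on the first vertices only. -/
theorem compare_prefix (h : IsExtremal m k L H x) {U U' : Finset (Finset ℕ)}
    (hU : powersetCard 3 (range k) \ H = U)
    (hU' : U' ⊆ powersetCard 3 (range k)) (hc : U.card ≤ U'.card)
    {n : ℕ} (hn : n ≤ k) {z : ℕ → ℝ} (hz : ∀ i < n, 0 ≤ z i)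
    (hs : ∑ i ∈ range n, z i = ∑ i ∈ range n, x i) :
    (∑ i ∈ range n, x i ^ 2 - ∑ i ∈ range n, z i ^ 2) / 2
      + (∑ i ∈ range n, z i ^ 3 - ∑ i ∈ range n, x i ^ 3) / 3
      + edgePoly U x - edgePoly U' (fun i => if i < n then z i else x i) ≤ 0 := by
  have key : ∀ f : ℝ → ℝ, ∑ i ∈ range k, f (if i < n then z i else x i)
      = ∑ i ∈ range k, f (x i) - ∑ i ∈ range n, f (x i) + ∑ i ∈ range n, f (z i) := by
    intro f
    rw [← sum_sdiff (range_subset_range.2 hn), ← sum_sdiff (range_subset_range.2 hn)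
      (f := fun i => f (x i))]
    have h1 : ∑ i ∈ range k \ range n, f (if i < n then z i else x i)
        = ∑ i ∈ range k \ range n, f (x i) := sum_congr rfl fun i hi => by
      rw [if_neg (by simpa using (mem_sdiff.1 hi).2)]
    have h2 : ∑ i ∈ range n, f (if i < n then z i else x i) = ∑ i ∈ range n, f (z i) :=
      sum_congr rfl fun i hi => by rw [if_pos (mem_range.1 hi)]
    rw [h1, h2]
    ring
  have h1 := key id
  have h2 := key fun r => r ^ 2
  have h3 := key fun r => r ^ 3
  simp only [id] at h1
  have h4 := h.compare hU' (by rwa [hU]) (y := fun i => if i < n then z i else x i) (fun i => by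
    split_ifs with hi
    · exact hz i hi
    · exact h.nonneg i) (by rw [h1, hs, h.sum_eq]; ring)
  rw [h2, h3, hU] at h4
  linarith

/-- The missing triples form a complete 3-graph on 0, 1, 2, 3, so these vertices have equal weight.
The competitor misses the four star triples on 0, …, 5. -/
theorem false_of_missing_complete (h : IsExtremal m k L H x) (hk : 6 ≤ k)
    (hU : powersetCard 3 (range k) \ H = insert {1, 2, 3} (insert {0, 2, 3} (pairStar 2))) :
    False := by
  have hn1 : ({0, 2, 3} : Finset ℕ) ∉ pairStar 2 := notMem_pairStar_of_one_notMem (by decide)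
  have hn2 : ({1, 2, 3} : Finset ℕ) ∉ insert {0, 2, 3} (pairStar 2) := by
    rw [mem_insert, not_or]
    exact ⟨by decide, notMem_pairStar_of_zero_notMem (by decide)⟩
  have hX := fun w => partialPoly_insert_triple hn2 (by decide) (by decide) (by decide) w x
  simp only [partialPoly_insert_triple hn1 (a := 0) (b := 2) (c := 3) (by decide) (by decide)
    (by decide)] at hX
  have X0 := hX 0
  have X1 := hX 1
  have X2 := hX 2
  have X3 := hX 3
  have X4 := hX 4
  have X5 := hX 5
  rw [partialPoly_pairStar_zero] at X0
  rw [partialPoly_pairStar_one] at X1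
  rw [partialPoly_pairStar_of_lt (by omega) (by omega)] at X2 X3
  rw [partialPoly_pairStar_of_ge (by omega)] at X4 X5
  simp [sum_range_succ] at X0 X1 X2 X3 X4 X5
  have K1 := h.sub_sq_add_partialPoly_compl (u := 0) (v := 1) (by omega) (by omega)
  have K2 := h.sub_sq_add_partialPoly_compl (u := 0) (v := 2) (by omega) (by omega)
  have K3 := h.sub_sq_add_partialPoly_compl (u := 0) (v := 3) (by omega) (by omega)
  have K4 := h.sub_sq_add_partialPoly_compl (u := 0) (v := 4) (by omega) (by omega)
  have K5 := h.sub_sq_add_partialPoly_compl (u := 4) (v := 5) (by omega) (by omega)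
  rw [hU] at K1 K2 K3 K4 K5
  rw [X0, X1] at K1
  rw [X0, X2] at K2
  rw [X0, X3] at K3
  rw [X0, X4] at K4
  rw [X4, X5] at K5
  have hsum := h.sum_range_le_one hk
  simp only [sum_range_succ, sum_range_zero] at hsum
  have p0 := h.pos (by omega : 0 < k)
  have p1 := h.pos (by omega : 1 < k)
  have p4 := h.pos (by omega : 4 < k)
  have p5 := h.pos (by omega : 5 < k)
  have h1 : x 1 = x 0 := eq_of_sub_mul_eq_zero (w := 1 - x 0 - x 1 - x 2 - x 3)
    (by linarith) (by linear_combination -K1)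
  have h2 : x 2 = x 0 := eq_of_sub_mul_eq_zero (w := 1 - x 0 - x 1 - x 2 - x 3)
    (by linarith) (by linear_combination -K2)
  have h3 : x 3 = x 0 := eq_of_sub_mul_eq_zero (w := 1 - x 0 - x 1 - x 2 - x 3)
    (by linarith) (by linear_combination -K3)
  have h5 : x 5 = x 4 := eq_of_sub_mul_eq_zero (w := 1 - x 4 - x 5)
    (by linarith [h.pos (by omega : 2 < k)]) (by linear_combination -K5)
  rw [h1, h2, h3] at K4
  rw [h1, h2, h3, h5] at hsum
  have hmono := h.mono 0 4 (by omega) (by omega)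
  have hlt : x 0 < x 4 := by
    refine lt_of_le_of_ne hmono fun heq => ?_
    rw [← heq] at K4
    nlinarith
  have hub : 4 * x 4 < 13 * x 0 := by
    by_contra! hge
    have e1 : (x 4 - x 0) * (3 * x 0 + x 4) ≤ (x 4 - x 0) * (1 - x 0 - x 4) :=
      mul_le_mul_of_nonneg_left (by linarith) (by linarith)
    nlinarith
  -- The vertices 0, 1, 4, 5 lose `ε` each and 2, 3 gain `2ε` each. This makes the weights constant
  -- on the two classes of the star and preserves both their sum and the sum of their squares; the
  -- total gain is $4\varepsilon^2(3x_4-13\varepsilon)$.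
  obtain ⟨ε, hε⟩ : ∃ ε, 3 * ε = x 4 - x 0 := ⟨(x 4 - x 0) / 3, by ring⟩
  have hx0 : x 0 = x 4 - 3 * ε := by linarith
  have hcmp := h.compare_prefix hU (U' := pairStar 4) (pairStar_subset (by omega))
    (by rw [card_insert_of_notMem hn2, card_insert_of_notMem hn1, card_pairStar, card_pairStar])
    hk (z := fun i => if i < 2 then x 4 - 4 * ε else x 4 - ε)
    (fun i _ => by split_ifs <;> linarith)
    (by simp [sum_range_succ, h1, h2, h3, h5]; linarith)
  rw [edgePoly_insert_triple hn2 (by decide) (by decide) (by decide),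
    edgePoly_insert_triple hn1 (by decide) (by decide) (by decide),
    edgePoly_pairStar, edgePoly_pairStar] at hcmp
  simp [sum_range_succ, h1, h2, h3, h5] at hcmp
  rw [hx0] at hcmp
  have hpos : 0 < ε ^ 2 * (3 * x 4 - 13 * ε) :=
    mul_pos (pow_pos (by linarith) 2) (by linarith)
  linarith

/-- If it failed, multiplying `hγK` by $D$ and cancelling $\gamma$ would give
$D(1-2a-\gamma)\le3(a^2-aD+D^2)$. With `hDK` this reads $D(6a-4D-\gamma)\le0$, impossible since
$D<a$ and $\gamma<a$. -/
theorem cone_weight_inequality {a D γ : ℝ} (ha : 0 < a) (hDa : D < a) (hD : 0 ≤ D) (hγ : 0 ≤ γ)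
    (hsum : 8 * a - D + 3 * γ ≤ 1) (hγK : γ * (1 - 2 * a - γ) = 3 * a * (a - D))
    (hDK : D * (1 - 2 * a + D) = 3 * a ^ 2 + 3 * a * D) :
    γ * (a ^ 2 - a * D + D ^ 2) < a * D * (a - D) := by
  have hD0 : 0 < D := by
    refine lt_of_le_of_ne hD fun heq => ?_
    rw [← heq] at hDK
    linarith [pow_pos ha 2]
  have haD : 0 < a * (a - D) := mul_pos ha (by linarith)
  have hγ0 : 0 < γ := by
    refine lt_of_le_of_ne hγ fun heq => ?_
    rw [← heq] at hγK
    linarith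
  by_contra! hge
  have e0 : D * (γ * (1 - 2 * a - γ)) = 3 * (a * D * (a - D)) := by rw [hγK]; ring
  have e1 : γ * (D * (1 - 2 * a - γ)) ≤ γ * (3 * (a ^ 2 - a * D + D ^ 2)) := by linarith
  have e2 := le_of_mul_le_mul_left e1 hγ0
  have hγa : γ < a := by
    refine lt_of_mul_lt_mul_right (a := 1 - 2 * a - γ) ?_ (by linarith)
    rw [hγK]
    have e3 := mul_le_mul_of_nonneg_left (show 5 * a ≤ 1 - 2 * a - γ by linarith) ha.le
    have e4 := mul_pos ha hD0
    have e5 := mul_pos ha ha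
    linarith
  have e6 := mul_pos hD0 (show 0 < 6 * a - 4 * D - γ by linarith)
  linarith

/-- The missing triples join 0 to all pairs from 1, 2, 3, 4. Those four vertices have equal weight,
and so do 5, 6, 7. -/
theorem false_of_missing_cone (h : IsExtremal m k L H x) (hk : 8 ≤ k)
    (hU : powersetCard 3 (range k) \ H
      = insert {0, 3, 4} (insert {0, 2, 4} (insert {0, 2, 3} (pairStar 3)))) : False := by
  have hn1 : ({0, 2, 3} : Finset ℕ) ∉ pairStar 3 := notMem_pairStar_of_one_notMem (by decide)
  have hn2 : ({0, 2, 4} : Finset ℕ) ∉ insert {0, 2, 3} (pairStar 3) := by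
    rw [mem_insert, not_or]
    exact ⟨by decide, notMem_pairStar_of_one_notMem (by decide)⟩
  have hn3 : ({0, 3, 4} : Finset ℕ) ∉ insert {0, 2, 4} (insert {0, 2, 3} (pairStar 3)) := by
    rw [mem_insert, mem_insert, not_or, not_or]
    exact ⟨by decide, by decide, notMem_pairStar_of_one_notMem (by decide)⟩
  have hX := fun w => partialPoly_insert_triple hn3 (by decide) (by decide) (by decide) w x
  simp only [partialPoly_insert_triple hn1 (a := 0) (b := 2) (c := 3) (by decide) (by decide)
    (by decide), partialPoly_insert_triple hn2 (a := 0) (b := 2) (c := 4) (by decide)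
    (by decide) (by decide)] at hX
  have X0 := hX 0
  have X1 := hX 1
  have X2 := hX 2
  have X3 := hX 3
  have X4 := hX 4
  have X5 := hX 5
  have X6 := hX 6
  have X7 := hX 7
  rw [partialPoly_pairStar_zero] at X0
  rw [partialPoly_pairStar_one] at X1
  rw [partialPoly_pairStar_of_lt (by omega) (by omega)] at X2 X3 X4
  rw [partialPoly_pairStar_of_ge (by omega)] at X5 X6 X7
  simp [sum_range_succ] at X0 X1 X2 X3 X4 X5 X6 X7
  have K2 := h.sub_sq_add_partialPoly_compl (u := 1) (v := 2) (by omega) (by omega)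
  have K3 := h.sub_sq_add_partialPoly_compl (u := 1) (v := 3) (by omega) (by omega)
  have K4 := h.sub_sq_add_partialPoly_compl (u := 1) (v := 4) (by omega) (by omega)
  have K1 := h.sub_sq_add_partialPoly_compl (u := 1) (v := 5) (by omega) (by omega)
  have K0 := h.sub_sq_add_partialPoly_compl (u := 0) (v := 1) (by omega) (by omega)
  have K6 := h.sub_sq_add_partialPoly_compl (u := 5) (v := 6) (by omega) (by omega)
  have K7 := h.sub_sq_add_partialPoly_compl (u := 5) (v := 7) (by omega) (by omega)
  rw [hU] at K0 K1 K2 K3 K4 K6 K7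
  rw [X1, X2] at K2
  rw [X1, X3] at K3
  rw [X1, X4] at K4
  rw [X1, X5] at K1
  rw [X0, X1] at K0
  rw [X5, X6] at K6
  rw [X5, X7] at K7
  have hsum := h.sum_range_le_one hk
  simp only [sum_range_succ, sum_range_zero] at hsum
  have p0 := h.pos (by omega : 0 < k)
  have p1 := h.pos (by omega : 1 < k)
  have p2 := h.pos (by omega : 2 < k)
  have p3 := h.pos (by omega : 3 < k)
  have p4 := h.pos (by omega : 4 < k)
  have p5 := h.pos (by omega : 5 < k)
  have p6 := h.pos (by omega : 6 < k)
  have p7 := h.pos (by omega : 7 < k)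
  have h2 : x 2 = x 1 := eq_of_sub_mul_eq_zero (w := 1 - x 1 - x 2 - x 0)
    (by linarith) (by linear_combination -K2)
  have h3 : x 3 = x 1 := eq_of_sub_mul_eq_zero (w := 1 - x 1 - x 3 - x 0)
    (by linarith) (by linear_combination -K3)
  have h4 : x 4 = x 1 := eq_of_sub_mul_eq_zero (w := 1 - x 1 - x 4 - x 0)
    (by linarith) (by linear_combination -K4)
  have h6 : x 6 = x 5 := eq_of_sub_mul_eq_zero (w := 1 - x 5 - x 6)
    (by linarith) (by linear_combination -K6)
  have h7 : x 7 = x 5 := eq_of_sub_mul_eq_zero (w := 1 - x 5 - x 7)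
    (by linarith) (by linear_combination -K7)
  rw [h2, h3, h4] at K0 K1
  rw [h2, h3, h4, h6, h7] at hsum
  have o01 := h.mono 0 1 (by omega) (by omega)
  have o15 := h.mono 1 5 (by omega) (by omega)
  -- The competitor averages the weights over the two classes {0, 1} and {2, …, 7} of the star. By
  -- the optimality conditions its gain is $\frac34\bigl(aD(a-D)-\gamma(a^2-aD+D^2)\bigr)$ in the
  -- notation below.
  have hcmp := h.compare_prefix hU (U' := pairStar 6) (pairStar_subset (by omega))
    (by rw [card_insert_of_notMem hn3, card_insert_of_notMem hn2, card_insert_of_notMem hn1,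
      card_pairStar, card_pairStar])
    hk (z := fun i => if i < 2 then (x 0 + x 1) / 2 else (x 1 + x 5) / 2)
    (fun i _ => by split_ifs <;> linarith)
    (by simp [sum_range_succ, h2, h3, h4, h6, h7]; ring)
  rw [edgePoly_insert_triple hn3 (by decide) (by decide) (by decide),
    edgePoly_insert_triple hn2 (by decide) (by decide) (by decide),
    edgePoly_insert_triple hn1 (by decide) (by decide) (by decide),
    edgePoly_pairStar, edgePoly_pairStar] at hcmp
  simp [sum_range_succ, h2, h3, h4, h6, h7] at hcmp
  obtain ⟨D, hD⟩ : ∃ D, x 0 = x 1 - D := ⟨x 1 - x 0, by ring⟩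
  obtain ⟨γ, hγ⟩ : ∃ γ, x 5 = x 1 + γ := ⟨x 5 - x 1, by ring⟩
  set a := x 1 with ha
  rw [hD] at K0 K1 hcmp hsum
  rw [hγ] at K1 hcmp hsum
  rw [hD] at p0 o01
  have K1' : γ * (1 - 2 * a - γ) = 3 * a * (a - D) := by linear_combination -K1
  have K0' : D * (1 - 2 * a + D) = 3 * a ^ 2 + 3 * a * D := by linear_combination -K0
  have hmain := cone_weight_inequality p1 (by linarith) (by linarith) (by linarith)
    (by linarith) K1' K0'
  have hγK : γ ^ 2 * (1 - 2 * a - γ) = 3 * a * (a - D) * γ := by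
    linear_combination γ * K1'
  have hDK : D ^ 2 * (1 - 2 * a + D) = (3 * a ^ 2 + 3 * a * D) * D := by
    linear_combination D * K0'
  linarith

/-- The missing edges of an extremal weighted graph all contain the two lightest vertices. -/
theorem compl_eq_pairStar (h : IsExtremal m k L H x)
    (h6 : (powersetCard 3 (range k) \ H).card ≤ 6)
    (hk : (powersetCard 3 (range k) \ H).card + 2 ≤ k) :
    powersetCard 3 (range k) \ H = pairStar (powersetCard 3 (range k) \ H).card := by
  have hn1 : ∀ d, ({0, 2, 3} : Finset ℕ) ∉ pairStar d := fun d =>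
    notMem_pairStar_of_one_notMem (by decide)
  have hn2 : ∀ d, ({1, 2, 3} : Finset ℕ) ∉ insert {0, 2, 3} (pairStar d) := fun d => by
    rw [mem_insert, not_or]
    exact ⟨by decide, notMem_pairStar_of_zero_notMem (by decide)⟩
  have hn3 : ∀ d, ({0, 2, 4} : Finset ℕ) ∉ insert {0, 2, 3} (pairStar d) := fun d => by
    rw [mem_insert, not_or]
    exact ⟨by decide, notMem_pairStar_of_one_notMem (by decide)⟩
  have hn4 : ({0, 2, 4} : Finset ℕ) ∉ insert {1, 2, 3} (insert {0, 2, 3} (pairStar 3)) := by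
    rw [mem_insert, not_or]
    exact ⟨by decide, hn3 3⟩
  have hn5 : ({0, 3, 4} : Finset ℕ) ∉ insert {0, 2, 4} (insert {0, 2, 3} (pairStar 3)) := by
    rw [mem_insert, mem_insert, not_or, not_or]
    exact ⟨by decide, by decide, notMem_pairStar_of_one_notMem (by decide)⟩
  obtain ⟨d, hU | ⟨hd, hU⟩ | ⟨hd, hU⟩ | ⟨hd, hU⟩ | ⟨rfl, hU⟩ | ⟨rfl, hU⟩⟩ :=
    h.isShifted_compl.classification
      (fun e he => (mem_powersetCard.1 (mem_sdiff.1 he).1).2) h6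
  · rw [hU, card_pairStar]
  · rw [hU, card_insert_of_notMem (hn1 d), card_pairStar] at hk
    obtain ⟨n, rfl⟩ := Nat.exists_eq_add_of_le' hd
    exact (h.false_of_missing_023 (by omega) hU).elim
  · rw [hU, card_insert_of_notMem (hn3 d), card_insert_of_notMem (hn1 d), card_pairStar] at hk
    obtain ⟨n, rfl⟩ := Nat.exists_eq_add_of_le' hd
    exact (h.false_of_missing_024 (by omega) hU).elim
  · rw [hU, card_insert_of_notMem (hn2 d), card_insert_of_notMem (hn1 d), card_pairStar] at hk
    rcases hd.eq_or_lt with rfl | hd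
    · exact (h.false_of_missing_complete (by omega) hU).elim
    · obtain ⟨n, rfl⟩ := Nat.exists_eq_add_of_le' (show 3 ≤ d from hd)
      exact (h.false_of_missing_123 (by omega) hU).elim
  · rw [hU, card_insert_of_notMem hn4, card_insert_of_notMem (hn2 3),
      card_insert_of_notMem (hn1 3), card_pairStar] at hk
    exact (h.false_of_missing_024_123 (by omega) hU).elim
  · rw [hU, card_insert_of_notMem hn5, card_insert_of_notMem (hn3 3),
      card_insert_of_notMem (hn1 3), card_pairStar] at hk
    exact (h.false_of_missing_cone (by omega) hU).elim

end IsExtremal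

/-! ### Embedding into the colex graph -/

section ColexGraph

/-- Initial segments of the colex order with at most `m` members consist of edges of `C_{3,m}`. -/
theorem subset_edges_colexGraph {r m : ℕ} {F : Finset (Finset ℕ+)} (hr : ∀ A ∈ F, A.card = r)
    (hF : ∀ A ∈ F, ∀ B : Finset ℕ+, B.card = r → toColex B < toColex A → B ∈ F)
    (hc : F.card ≤ m) : F ⊆ (colexGraph r m).edges := by
  intro A hA
  refine (colexFirst_finite r m).mem_toFinset.2 ⟨hr A hA, ?_⟩
  have h1 : colexBelow r A ⊆ (F.erase A : Finset (Finset ℕ+)) := fun B hB => by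
    rw [mem_coe, mem_erase]
    refine ⟨?_, hF A hA B hB.1 hB.2⟩
    rintro rfl
    exact lt_irrefl _ hB.2
  refine (Set.encard_le_encard h1).trans_lt ?_
  rw [Set.encard_coe_eq_coe_finsetCard]
  exact_mod_cast (card_erase_lt_of_mem hA).trans_le hc

/-- A vertex `i < t` of weight order `i` plays the role of the positive integer `t - i`. -/
theorem edgePoly_le_lagrangian_colexGraph {m t : ℕ} {H : Finset (Finset ℕ)}
    (hH : H ⊆ powersetCard 3 (range t)) (hc : H.card ≤ m)
    (hcl : ∀ e ∈ H, ∀ b ∈ powersetCard 3 (range t),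
      (∀ j ∈ b, j ∉ e → ∃ c ∈ e, c ∉ b ∧ c ≤ j) → b ∈ H)
    (hcov : ∀ i < t, ∃ e ∈ H, i ∈ e) {x : ℕ → ℝ} (hx : ∀ i, 0 ≤ x i)
    (hs : ∑ i ∈ range t, x i = 1) : edgePoly H x ≤ (colexGraph 3 m).lagrangian := by
  let φ : ℕ → ℕ+ := fun i => (t - 1 - i).succPNat
  let ψ : ℕ+ → ℕ := fun j => t - j
  have hφ : ∀ i, (φ i : ℕ) = t - 1 - i + 1 := fun i => Nat.succPNat_coe _
  have hψφ : ∀ i < t, ψ (φ i) = i := fun i hi => by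
    simp only [ψ, hφ]
    omega
  have hφψ : ∀ j : ℕ+, (j : ℕ) ≤ t → φ (ψ j) = j := fun j hj => by
    have := j.pos
    refine PNat.eq ?_
    simp only [ψ, hφ]
    omega
  have hψt : ∀ j : ℕ+, (j : ℕ) ≤ t → ψ j < t := fun j hj => by
    have := j.pos
    simp only [ψ]
    omega
  have hφle : ∀ i < t, (φ i : ℕ) ≤ t := fun i hi => by
    rw [hφ]
    omega
  have hinj : Set.InjOn φ (range t) := fun i hi j hj hij => by
    rw [← hψφ i (by simpa using hi), hij, hψφ j (by simpa using hj)]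
  have hsub : ∀ e ∈ H, e ⊆ range t := fun e he => (mem_powersetCard.1 (hH he)).1
  have himg : ∀ e ∈ H, (e.image φ).image ψ = e := fun e he => by
    rw [image_image]
    conv_rhs => rw [← image_id (s := e)]
    exact image_congr fun i hi => hψφ i (mem_range.1 (hsub e he hi))
  have hinj' : Set.InjOn (image φ) (H : Set (Finset ℕ)) := fun e he f hf hef => by
    rw [← himg e he, hef, himg f hf]
  set F := H.image (image φ) with hFdef
  have hF : F ⊆ (colexGraph 3 m).edges := by
    refine subset_edges_colexGraph ?_ ?_ (card_image_le.trans hc)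
    · simp only [F, forall_mem_image]
      intro e he
      rw [card_image_of_injOn (hinj.mono (by exact_mod_cast hsub e he))]
      exact (mem_powersetCard.1 (hH he)).2
    · simp only [F, forall_mem_image]
      intro e he B hB hlt
      have hle := Colex.toColex_le_toColex.1 hlt.le
      have hBt : ∀ b ∈ B, (b : ℕ) ≤ t := fun b hb => by
        have key : ∀ a ∈ e.image φ, (a : ℕ) ≤ t := by
          simp only [forall_mem_image]
          exact fun i hi => hφle i (mem_range.1 (hsub e he hi))
        by_cases hbe : b ∈ e.image φ
        · exact key b hbe
        · obtain ⟨c, hce, -, hbc⟩ := hle hb hbe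
          exact le_trans (by exact_mod_cast hbc) (key c hce)
      have hBimg : (B.image ψ).image φ = B := by
        rw [image_image]
        conv_rhs => rw [← image_id (s := B)]
        exact image_congr fun b hb => hφψ b (hBt b hb)
      rw [← hBimg]
      refine mem_image_of_mem _ (hcl e he _ ?_ ?_)
      · rw [mem_powersetCard]
        refine ⟨image_subset_iff.2 fun b hb => mem_range.2 (hψt b (hBt b hb)), ?_⟩
        rw [card_image_of_injOn, hB]
        intro b hb c hc hbc
        rw [← hφψ b (hBt b hb), hbc, hφψ c (hBt c hc)]
      · simp only [forall_mem_image]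
        intro b hb hbe
        have hbe' : b ∉ e.image φ := fun h => hbe (by
          rw [← himg e he]
          exact mem_image_of_mem _ h)
        obtain ⟨c, hce, hcB, hbc⟩ := hle hb hbe'
        obtain ⟨i, hi, rfl⟩ := mem_image.1 hce
        have hit := mem_range.1 (hsub e he hi)
        refine ⟨i, hi, fun h => hcB ?_, ?_⟩
        · rw [← hBimg]
          exact mem_image_of_mem _ h
        · have : (b : ℕ) ≤ φ i := by exact_mod_cast hbc
          rw [hφ] at this
          simp only [ψ]
          omega
  let y : ℕ+ → ℝ := fun j => if (j : ℕ) ≤ t then x (ψ j) else 0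
  have hy : ∀ i < t, y (φ i) = x i := fun i hi => by
    simp only [y, if_pos (hφle i hi), hψφ i hi]
  have hy0 : ∀ j, 0 ≤ y j := fun j => by
    simp only [y]
    split_ifs
    · exact hx _
    · exact le_rfl
  -- A legal weighting must have total weight 1 on the vertices of the colex graph, so every
  -- weighted vertex has to lie in an edge; this is the role of `hcov`.
  have hV : (range t).image φ ⊆ (colexGraph 3 m).verts := by
    refine image_subset_iff.2 fun i hi => ?_
    obtain ⟨e, he, hie⟩ := hcov i (mem_range.1 hi)
    exact (colexGraph 3 m).subset_verts _ (hF (mem_image_of_mem _ he)) (mem_image_of_mem _ hie)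
  have hlegal : y ∈ (colexGraph 3 m).legalWeightings := by
    refine ⟨fun i _ => hy0 i, ?_⟩
    rw [← sum_subset hV, sum_image hinj, ← hs]
    · exact sum_congr rfl fun i hi => hy i (mem_range.1 hi)
    · intro j _ hj
      refine if_neg fun hjt => hj ?_
      rw [← hφψ j hjt]
      exact mem_image_of_mem _ (mem_range.2 (hψt j hjt))
  have hne : (colexGraph 3 m).verts.Nonempty := by
    by_contra h0
    have := hlegal.2
    rw [not_nonempty_iff_eq_empty.1 h0, sum_empty] at this
    exact zero_ne_one this
  refine le_trans ?_ (((colexGraph 3 m).isGreatest_lagrangian hne).2 ⟨y, hlegal, rfl⟩)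
  calc edgePoly H x = ∑ e ∈ F, ∏ i ∈ e, y i := by
        rw [hFdef, sum_image hinj']
        refine sum_congr rfl fun e he => ?_
        rw [prod_image (hinj.mono (by exact_mod_cast hsub e he))]
        exact prod_congr rfl fun i hi => (hy i (mem_range.1 (hsub e he hi))).symm
    _ ≤ (colexGraph 3 m).lagrangePoly y :=
        sum_le_sum_of_subset_of_nonneg hF fun _ _ _ => prod_nonneg fun i _ => hy0 i

end ColexGraph

/-! ### Induction on the number of vertices -/

theorem LagrangianBound.mono_edges {m m' k : ℕ} {L : ℝ} (h : LagrangianBound m' k L)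
    (hm : m ≤ m') : LagrangianBound m k L :=
  fun H hH hc => h H hH (hc.trans hm)

theorem LagrangianBound.mono_vertices {m k k' : ℕ} {L : ℝ} (h : LagrangianBound m k' L)
    (hk : k ≤ k') : LagrangianBound m k L := by
  intro H hH hc x hx hs
  rw [edgePoly_congr hH (y := fun i => if i < k then x i else 0) fun i hi => by rw [if_pos hi]]
  refine h H (hH.trans (powersetCard_mono (range_subset_range.2 hk))) hc _ (fun i => ?_) ?_
  · split_ifs
    · exact hx i
    · exact le_rfl
  · rw [← hs, ← sum_subset (range_subset_range.2 hk)]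
    · exact sum_congr rfl fun i hi => if_pos (mem_range.1 hi)
    · exact fun i _ hi => if_neg (by simpa using hi)

theorem LagrangianBound.lagrangian_le {m : ℕ} {L : ℝ} (h : ∀ k, LagrangianBound m k L)
    {α : Type*} (G : RGraph 3 α) (hG : G.edges.card = m) (hne : G.verts.Nonempty) :
    G.lagrangian ≤ L := by
  classical
  obtain ⟨x, ⟨hx, hs⟩, hval⟩ := (G.isGreatest_lagrangian hne).1
  obtain ⟨H, hH, hc, y, hy, hys, -, heq⟩ := exists_sorted_relabelling (V := G.verts) rfl
    G.card_eq hx fun e he hne => absurd (G.subset_verts e he) hne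
  rw [← hval]
  exact heq.symm.trans_le (h _ H hH (hc.trans hG.le) y hy (hys.trans hs))

theorem exists_triple_mem {k i : ℕ} (hk : 3 ≤ k) (hi : i < k) :
    ∃ e ∈ powersetCard 3 (range k), i ∈ e := by
  obtain ⟨e, h1, h2, h3⟩ := exists_subsuperset_card_eq
    (singleton_subset_iff.2 (mem_range.2 hi)) (n := 3) (by simp) (by simpa using hk)
  exact ⟨e, mem_powersetCard.2 ⟨h2, h3⟩, h1 (mem_singleton_self i)⟩

/-- As long as `C_{3,m}` contains the complete graph on `k` vertices, weightings of `k` vertices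
cannot beat it. -/
theorem lagrangianBound_colexGraph_of_choose_le {m k : ℕ} (hk : 3 ≤ k) (hm : k.choose 3 ≤ m)
    (m' : ℕ) : LagrangianBound m' k (colexGraph 3 m).lagrangian := fun H hH _ x hx hs =>
  (edgePoly_mono hH hx).trans (edgePoly_le_lagrangian_colexGraph (Subset.refl _)
    (by rwa [card_powersetCard, card_range]) (fun _ _ b hb _ => hb)
    (fun _ hi => exists_triple_mem hk hi) hx hs)

/-- Ten edges contain the complete 3-graph on five vertices, whose value at equal weights is
$10/125$. -/
theorem two_div_le_lagrangian_colexGraph {m : ℕ} (hm : 10 ≤ m) :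
    2 / 25 ≤ (colexGraph 3 m).lagrangian := by
  have h := lagrangianBound_colexGraph_of_choose_le (k := 5) (by norm_num)
    (by simpa [Nat.choose] using hm) 10 _ (Subset.refl _) (by simp [Nat.choose])
    (fun _ => 1 / 5) (fun _ => by norm_num) (by simp)
  refine le_trans (le_of_eq ?_) h
  rw [edgePoly, sum_congr rfl fun e he => by rw [prod_const, (mem_powersetCard.1 he).2],
    sum_const, card_powersetCard, card_range]
  norm_num [Nat.choose]

theorem exists_eq_triple {e : Finset ℕ} (he : e.card = 3) (h0 : 0 ∈ e) (h1 : 1 ∈ e) :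
    ∃ s, s ≠ 0 ∧ s ≠ 1 ∧ e = {0, 1, s} := by
  have hsub : ({0, 1} : Finset ℕ) ⊆ e := by
    simp [insert_subset_iff, h0, h1]
  have hc := card_sdiff_of_subset hsub
  rw [he, card_pair zero_ne_one] at hc
  obtain ⟨s, hs⟩ := card_eq_one.1 hc
  have hse : s ∈ e \ {0, 1} := hs ▸ mem_singleton_self s
  simp only [mem_sdiff, mem_insert, mem_singleton, not_or] at hse
  refine ⟨s, hse.2.1, hse.2.2, ?_⟩
  rw [← sdiff_union_of_subset hsub, hs]
  ext j
  simp only [mem_union, mem_insert, mem_singleton]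
  tauto

/-- Under the reversal $i\mapsto t-i$ the star consists of the last triples in colex order, so its
complement is an initial segment. -/
theorem sdiff_pairStar_colexClosed {t d : ℕ} {e b : Finset ℕ} (he : e ∈ powersetCard 3 (range t))
    (hed : e ∉ pairStar d) (h : ∀ j ∈ b, j ∉ e → ∃ c ∈ e, c ∉ b ∧ c ≤ j) :
    b ∉ pairStar d := by
  rw [mem_pairStar] at hed ⊢
  rintro ⟨i, hi, rfl⟩
  have h0 : 0 ∈ e := by
    by_contra h0
    obtain ⟨c, hc, hcb, hc0⟩ := h 0 (by simp) h0
    obtain rfl : c = 0 := by omega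
    exact h0 hc
  have h1 : 1 ∈ e := by
    by_contra h1
    obtain ⟨c, hc, hcb, hc1⟩ := h 1 (by simp) h1
    simp only [mem_insert, mem_singleton, not_or] at hcb
    omega
  obtain ⟨s, hs0, hs1, rfl⟩ := exists_eq_triple (mem_powersetCard.1 he).2 h0 h1
  have hsd : d + 2 ≤ s := by
    by_contra! hlt
    exact hed ⟨s - 2, by omega, by rw [show s - 2 + 2 = s by omega]⟩
  obtain ⟨c, hc, hcb, hci⟩ := h (i + 2) (by simp) (by
    simp only [mem_insert, mem_singleton, not_or]
    omega)
  simp only [mem_insert, mem_singleton, not_or] at hc hcb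
  omega

theorem lagrangianBound_colexGraph_succ {m t p : ℕ} (ht : 4 ≤ t) (hp : p ≤ 6)
    (hm : m + p = (t + 1).choose 3) (hm' : t.choose 3 ≤ m) :
    LagrangianBound m (t + 1) (colexGraph 3 m).lagrangian := by
  -- Only $t-1$ triples on $t+1$ vertices contain 0 and 1, so a star of size $p$ may not fit. In
  -- that case extra edges are allowed until just $q=t-1$ triples are missing.
  obtain ⟨q, hqp, hqt, hq⟩ : ∃ q, q ≤ p ∧ q + 1 ≤ t ∧ (q = p ∨ q + 1 = t) := by
    rcases le_total (p + 1) t with h | h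
    · exact ⟨p, le_rfl, h, Or.inl rfl⟩
    · exact ⟨t - 1, by omega, by omega, by omega⟩
  refine LagrangianBound.mono_edges (m' := m + (p - q)) ?_ (by omega)
  by_contra hn
  obtain ⟨H, x, h⟩ := exists_isExtremal
    (lagrangianBound_colexGraph_of_choose_le (by omega) hm' _) hn
  have hHc := h.card_eq (by omega)
  have hUc : (powersetCard 3 (range (t + 1)) \ H).card = q := by
    rw [card_sdiff_of_subset h.subset, card_powersetCard, card_range, hHc]
    omega
  have hU := h.compl_eq_pairStar (by omega) (by omega)
  rw [hUc] at hU
  have hmem : ∀ e, e ∈ H ↔ e ∈ powersetCard 3 (range (t + 1)) ∧ e ∉ pairStar q := fun e => by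
    rw [← mem_sdiff, ← hU, Finset.sdiff_sdiff_eq_self h.subset]
  have hcl : ∀ e ∈ H, ∀ b ∈ powersetCard 3 (range (t + 1)),
      (∀ j ∈ b, j ∉ e → ∃ c ∈ e, c ∉ b ∧ c ≤ j) → b ∈ H := fun e he b hb hbe =>
    (hmem b).2 ⟨hb, sdiff_pairStar_colexClosed ((hmem e).1 he).1 ((hmem e).1 he).2 hbe⟩
  have hcov : ∀ i < t + 1, ∃ e ∈ H, i ∈ e := fun i hi => by
    obtain ⟨e, he, hie, -⟩ := h.exists_edge hi (v := if i = 0 then 1 else 0)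
      (by split_ifs <;> omega) (by split_ifs <;> omega)
    exact ⟨e, he, hie⟩
  -- Otherwise all triples through 0 and 1 would be missing, but every pair of vertices is covered.
  have hqp' : q = p := by
    by_contra hne
    obtain ⟨e, he, h0, h1⟩ := h.exists_edge (u := 0) (v := 1) (by omega) (by omega) zero_ne_one
    obtain ⟨he3, hes⟩ := (hmem e).1 he
    obtain ⟨s, hs0, hs1, rfl⟩ := exists_eq_triple (mem_powersetCard.1 he3).2 h0 h1
    have hst := mem_range.1 ((mem_powersetCard.1 he3).1 (show s ∈ {0, 1, s} by simp))
    exact hes (mem_pairStar.2 ⟨s - 2, by omega, by rw [show s - 2 + 2 = s by omega]⟩)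
  exact h.lt.not_ge (edgePoly_le_lagrangian_colexGraph h.subset (by omega) hcl hcov h.nonneg
    h.sum_eq)

theorem lagrangianBound_colexGraph {m t p : ℕ} (hm : 0 < m) (hp3 : 3 ≤ p) (hp : p ≤ 6)
    (hmt : m + p = t.choose 3) (k : ℕ) : LagrangianBound m k (colexGraph 3 m).lagrangian := by
  have ht : 4 ≤ t := by
    by_contra! hlt
    have := Nat.choose_le_choose 3 (show t ≤ 3 by omega)
    simp at this
    omega
  obtain ⟨s, rfl⟩ := Nat.exists_eq_add_of_le' (show 1 ≤ t by omega)
  have hpascal := Nat.choose_succ_succ s 2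
  simp only [Nat.succ_eq_add_one, Nat.reduceAdd] at hpascal
  -- For $s\ge4$, $p\le6\le\binom s2=\binom{s+1}3-\binom s3$. For $s=3$ only $m=1$ is possible, and
  -- the claim is immediate.
  have hs : s.choose 3 ≤ m := by
    rcases (show 3 ≤ s by omega).eq_or_lt with rfl | hs
    · simpa using Nat.one_le_iff_ne_zero.2 hm.ne'
    · have := Nat.choose_le_choose 2 (show 4 ≤ s from hs)
      simp [Nat.choose] at this
      omega
  have hbase := lagrangianBound_colexGraph_of_choose_le (by omega) hs m
  have hstep : ∀ n, s + 1 ≤ n → LagrangianBound m n (colexGraph 3 m).lagrangian := by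
    intro n hn
    induction n, hn using Nat.le_induction with
    | base =>
      rcases (show 3 ≤ s by omega).eq_or_lt with rfl | hs'
      · refine hbase.succ_of_lt_choose (by norm_num) ?_
        simp [Nat.choose] at hmt ⊢
        omega
      · exact lagrangianBound_colexGraph_succ hs' hp hmt hs
    | succ n hn ih =>
      -- For $s\le4$ one has $m\le7$, and the degree bound at the heaviest vertex suffices. For
      -- $s\ge5$ there are at least ten edges, which supplies the lower bound $2/25$.
      rcases lt_or_ge s 5 with hs5 | hs5
      · refine ih.succ_of_lt_choose (by omega) ?_
        have h2 := Nat.choose_le_choose 2 hn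
        have h3 : s = 3 ∨ s = 4 := by omega
        rcases h3 with rfl | rfl <;> simp [Nat.choose] at hmt h2 <;> omega
      · refine ih.succ_of_le_choose (by omega) ?_ (two_div_le_lagrangian_colexGraph ?_)
        · have := Nat.choose_le_choose 3 hn
          omega
        · have := Nat.choose_le_choose 3 hs5
          simp [Nat.choose] at this
          omega
  rcases le_total (s + 1) k with hk | hk
  · exact hstep k hk
  · exact (hstep _ le_rfl).mono_vertices hk

theorem corollary1p13 (m t : ℕ) (hm : 0 < m) (ht : 0 < t)
    (hlow : ((t.choose 3 : ℕ) : ℤ) - 6 ≤ (m : ℤ))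
    (hupp : (m : ℤ) ≤ ((t.choose 3 : ℕ) : ℤ) - 3) :
    (colexGraph 3 m).edges.card = m ∧
      ∀ {α : Type*} (G : RGraph 3 α), G.edges.card = m →
        G.lagrangian ≤ (colexGraph 3 m).lagrangian := by
  refine ⟨colexGraph_card_edges (by norm_num) m, fun G hG => ?_⟩
  refine LagrangianBound.lagrangian_le (m := m) (lagrangianBound_colexGraph (t := t)
    (p := t.choose 3 - m) hm (by omega) (by omega) (by omega)) G hG ?_
  obtain ⟨e, he⟩ := card_pos.1 (hG ▸ hm)
  obtain ⟨i, hi⟩ := card_pos.1 (by rw [G.card_eq e he]; norm_num : 0 < e.card)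
  exact ⟨i, G.subset_verts e he hi⟩
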